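/- **Conventions.** $\|\cdot\|_{\mathrm{op}}$ is the operator norm (largest singular value) of a matrix. Let $\mathbb X\subset\mathbb R^D$ be compact and let $\lambda:\mathbb X\to[0,\infty)$ be Lebesgue integrable. A point process in $\mathbb X$ is a random set of points $N\subseteq\mathbb X$, measurable with respect to the $\sigma$-algebra on configurations generated by the counts $N(S)=|N\cap S|$, $S$ compact. It is an (inhomogeneous) Poisson point process with intensity function $\lambda$ if (1) for every compact $S\subseteq\mathbb X$ the count $N(S)$ is Poisson distributed with mean $\int_S\lambda(x)\,dx$, and (2) for all pairwise disjoint compact $S_1,\dots,S_w\subseteq\mathbb X$ the counts $N(S_1),\dots,N(S_w)$ are independent. **Theorem (matrix Bernstein inequality for Poisson point processes).** Let $d_1,d_2\ge 1$, let $F:\mathbb X\to\mathbb R^{d_1\times d_2}$ be continuous, and let $0\le L<\infty$ satisfy $\|F(x)\|_{\mathrm{op}}\le L$ for all $x\in\mathbb X$. Put $$\nu=\max\left\{\left\|\int_{\mathbb X}F(x)F(x)^{\top}\lambda(x)\,dx\right\|_{\mathrm{op}},\ \left\|\int_{\mathbb X}F(x)^{\top}F(x)\lambda(x)\,dx\right\|_{\mathrm{op}}\right\}.$$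 (i) Let $N$ be a Poisson point process in $\mathbb X$ with intensity function $\lambda$. For all $t\ge 0$, $$\mathbb P\left(\left\|\sum_{X\in N}F(X)-\int_{\mathbb X}F(x)\lambda(x)\,dx\right\|_{\mathrm{op}}\ge t\right)\le(d_1+d_2)\exp\left(-\frac{t^2/2}{\nu+Lt/3}\right),$$ and for all real $a\ge 2$, with probability at least $1-2(\max\{d_1,d_2\})^{1-a}$, $$\left\|\sum_{X\in N}F(X)-\int_{\mathbb X}F(x)\lambda(x)\,dx\right\|_{\mathrm{op}}\le\sqrt{2a\nu\log(d_1+d_2)}+\frac{2a}{3}L\log(d_1+d_2).$$ (ii) Let $N^{(1)},\dots,N^{(n)}$ be i.i.d. Poisson point processes in $\mathbb X$ with intensity function $\lambda$, and put $\nu_n=n\nu$. For all $t\ge0$, $$\mathbb P\left(\left\|\sum_{i=1}^n\sum_{X\in N^{(i)}}F(X)-n\int_{\mathbb X}F(x)\lambda(x)\,dx\right\|_{\mathrm{op}}\ge t\right)\le(d_1+d_2)\exp\left(-\frac{t^2/2}{\nu_n+Lt/3}\right),$$ and for all real $a\ge 2$, with probability at least $1-2(\max\{d_1,d_2\})^{1-a}$,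 $$\left\|\sum_{i=1}^n\sum_{X\in N^{(i)}}F(X)-n\int_{\mathbb X}F(x)\lambda(x)\,dx\right\|_{\mathrm{op}}\le\sqrt{2a\nu_n\log(d_1+d_2)}+\frac{2a}{3}L\log(d_1+d_2).$$ In the exponents, a quotient whose denominator is $0$ is read as $0$; for $t>0$ this can only happen in the trivial case where $L=0$, hence $F=0$. -/

import Mathlib

open MeasureTheory ProbabilityTheory
open scoped Matrix Matrix.Norms.L2Operator

/-- The number of points of the configuration `A` that lie in `S`. -/
noncomputable def pointCount {D : ℕ} (S A : Set (EuclideanSpace ℝ (Fin D))) : ℕ∞ :=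
  (A ∩ S).encard

/-- The σ-algebra on point configurations generated by the counts on compact sets. -/
@[reducible]
noncomputable def configurationSigma (D : ℕ) : MeasurableSpace (Set (EuclideanSpace ℝ (Fin D))) :=
  ⨆ S : {S : Set (EuclideanSpace ℝ (Fin D)) // IsCompact S},
    MeasurableSpace.comap (pointCount S.1) inferInstance

/-- `N` is a Poisson point process in `X` with (Lebesgue-)intensity function `lam`, under the
probability measure `P`. Almost sure finiteness of the configuration on compact sets is part of
`count_law`, because the Poisson law gives no mass to `⊤ : ℕ∞`. -/
structure IsPoissonPointProcess {Ω : Type*} [MeasurableSpace Ω] (P : Measure Ω) {D : ℕ}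
    (X : Set (EuclideanSpace ℝ (Fin D))) (lam : EuclideanSpace ℝ (Fin D) → ℝ)
    (N : Ω → Set (EuclideanSpace ℝ (Fin D))) : Prop where
  subset : ∀ ω, N ω ⊆ X
  measurable : Measurable[_, configurationSigma D] N
  count_law : ∀ S : Set (EuclideanSpace ℝ (Fin D)), IsCompact S → S ⊆ X →
    HasLaw (fun ω => pointCount S (N ω))
      ((poissonMeasure (∫ x in S, lam x).toNNReal).map (Nat.cast : ℕ → ℕ∞)) P
  count_indep : ∀ (w : ℕ) (S : Fin w → Set (EuclideanSpace ℝ (Fin D))),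
    (∀ i, IsCompact (S i) ∧ S i ⊆ X) → Pairwise (fun i j => Disjoint (S i) (S j)) →
    iIndepFun (fun i ω => pointCount (S i) (N ω)) P

/-- The variance statistic of `F` with respect to `lam` on `X`; `‖·‖` is the `ℓ²` operator norm. -/
noncomputable def varianceStat {D d₁ d₂ : ℕ} (X : Set (EuclideanSpace ℝ (Fin D)))
    (lam : EuclideanSpace ℝ (Fin D) → ℝ)
    (F : EuclideanSpace ℝ (Fin D) → Matrix (Fin d₁) (Fin d₂) ℝ) : ℝ :=
  max ‖∫ x in X, lam x • (F x * (F x)ᵀ)‖ ‖∫ x in X, lam x • ((F x)ᵀ * F x)‖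

/-! This is the Laplace transform method for matrices. If a compact set is cut into small disjoint
compact cells and `F` is frozen at one point per cell, the sum over the process becomes a compound
Poisson matrix `∑ j, k j • S j` with independent Poisson counts. Its self-adjoint dilation is
symmetric, and `exp_norm_le_trace_exp_dilation` bounds `exp ‖S‖` by a trace exponential, so Markov's
inequality reduces the tail to a bound on an expected trace exponential.

That bound needs no Lieb concavity, because a compound Poisson variable is infinitely divisible. It
is the limit of walks with `r` identically distributed steps, each either a pure drift or one jump.
Golden–Thompson (`trace_exp_add_le`) peels off one step at a time, each costing a factor at most `1
+ (κ + ε) / r`. Since all steps have the same law, bounding each by its largest eigenvalue loses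
nothing in the limit, and `sum_prod_poisson_mul_trace_exp_le` yields `exp κ` times the dimension.
Here `κ` bounds the form of `∑ j, lam j • (exp (A j) - 1 - A j)`, which
`dotProduct_sum_exp_dilation_le` compares with the variance.

The tail bound for finitely many jump values is `measure_le_norm_sum_poisson_smul_sub`. The errors
of discretization are collected in `measureReal_le_norm_sub_le_discretized` and vanish with the
mesh. Optimizing `θ` in `measureReal_le_norm_sub_le_bernstein` gives the Bernstein exponent, and
choosing `t` gives the high-probability form. Several independent processes only enlarge the index
set of cells. -/

/-! ### Trace inequalities of Hölder and Lieb–Thirring type for dyadic powers. -/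

namespace Matrix

variable {n : Type*} [Fintype n] [DecidableEq n]

omit [DecidableEq n] in
/-- Cauchy–Schwarz for the trace form, in bounded form. -/
lemma abs_trace_mul_le_of_trace_mul_transpose_le {A B : Matrix n n ℝ} {c : ℝ}
    (hA : (A * Aᵀ).trace ≤ c) (hB : (B * Bᵀ).trace ≤ c) : |(A * B).trace| ≤ c := by
  have h2 : (B * Bᵀ).trace = ∑ i, ∑ j, B j i ^ 2 := by
    rw [Finset.sum_comm]
    simp [Matrix.trace, Matrix.mul_apply, sq]
  have h1 : (A * Aᵀ).trace = ∑ i, ∑ j, A i j ^ 2 := by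
    simp [Matrix.trace, Matrix.mul_apply, sq]
  have h3 : |(A * B).trace| ≤ ∑ i, ∑ j, (A i j ^ 2 + B j i ^ 2) / 2 := by
    simp only [Matrix.trace, Matrix.mul_apply, Matrix.diag_apply]
    refine (Finset.abs_sum_le_sum_abs _ _).trans (Finset.sum_le_sum fun i _ => ?_)
    refine (Finset.abs_sum_le_sum_abs _ _).trans (Finset.sum_le_sum fun j _ => ?_)
    rw [abs_mul]
    nlinarith [sq_nonneg (|A i j| - |B j i|), sq_abs (A i j), sq_abs (B j i)]
  have h4 : ∑ i, ∑ j, (A i j ^ 2 + B j i ^ 2) / 2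
      = ((A * Aᵀ).trace + (B * Bᵀ).trace) / 2 := by
    rw [h1, h2, ← Finset.sum_add_distrib, Finset.sum_div]
    refine Finset.sum_congr rfl fun i _ => ?_
    rw [← Finset.sum_add_distrib, Finset.sum_div]
  linarith

lemma trace_mul_pow_comm (A B : Matrix n n ℝ) (p : ℕ) :
    ((A * B) ^ p).trace = ((B * A) ^ p).trace := by
  cases p with
  | zero => simp
  | succ p =>
    have h : ∀ k : ℕ, (A * B) ^ k * A = A * (B * A) ^ k := fun k => by
      induction k with
      | zero => simp
      | succ k ih => rw [pow_succ', pow_succ', Matrix.mul_assoc, ih]; simp only [Matrix.mul_assoc]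
    rw [pow_succ, ← Matrix.mul_assoc, h, Matrix.trace_mul_comm, pow_succ' (B * A),
      Matrix.mul_assoc]

lemma prod_map_range_two_mul {M : Type*} [Monoid M] (Z : ℕ → M) (k : ℕ) :
    ((List.range (2 * k)).map Z).prod
      = ((List.range k).map fun i => Z (2 * i) * Z (2 * i + 1)).prod := by
  induction k with
  | zero => simp
  | succ k ih =>
    rw [show 2 * (k + 1) = 2 * k + 1 + 1 by ring, List.range_succ, List.range_succ,
      List.range_succ (n := k)]
    simp [ih]

/-- A dyadic Hölder inequality for the trace of a product of matrices. -/
lemma abs_trace_prod_le_of_dyadic (q : ℕ) {c : ℝ} (Z : ℕ → Matrix n n ℝ)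
    (hZ : ∀ i, ((Z i * (Z i)ᵀ) ^ 2 ^ q).trace ≤ c) :
    |((List.range (2 ^ (q + 1))).map Z).prod.trace| ≤ c := by
  induction q generalizing Z with
  | zero =>
    have := abs_trace_mul_le_of_trace_mul_transpose_le (A := Z 0) (B := Z 1) (c := c)
      (by simpa using hZ 0) (by simpa using hZ 1)
    simpa [List.range_succ] using this
  | succ q ih =>
    -- The induction hypothesis is used twice: on the products `A * B` of neighbours, and then on
    -- the alternating word in `Aᵀ * A` and `B * Bᵀ` to which the trace of `(A * B * (A * B)ᵀ) ^ 2 ^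
    -- q` reduces by cyclicity.
    rw [pow_succ', prod_map_range_two_mul]
    refine ih _ fun i => ?_
    set A := Z (2 * i)
    set B := Z (2 * i + 1)
    have h1 : ((A * B * (A * B)ᵀ) ^ 2 ^ q).trace = (((Aᵀ * A) * (B * Bᵀ)) ^ 2 ^ q).trace := by
      rw [Matrix.transpose_mul, show A * B * (Bᵀ * Aᵀ) = (A * (B * Bᵀ)) * Aᵀ by
        simp only [Matrix.mul_assoc], trace_mul_pow_comm]
      simp only [Matrix.mul_assoc]
    have h2 : ((List.range (2 ^ (q + 1))).map
        fun i => if i % 2 = 0 then Aᵀ * A else B * Bᵀ).prod = ((Aᵀ * A) * (B * Bᵀ)) ^ 2 ^ q := by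
      rw [pow_succ', prod_map_range_two_mul]
      simp [Nat.add_mod]
    rw [h1, ← h2]
    refine (le_abs_self _).trans (ih _ fun j => ?_)
    split_ifs
    · have := hZ (2 * i)
      rw [Matrix.transpose_mul, Matrix.transpose_transpose, ← sq, ← pow_mul, ← pow_succ',
        trace_mul_pow_comm]
      exact this
    · have := hZ (2 * i + 1)
      rw [Matrix.transpose_mul, Matrix.transpose_transpose, ← sq, ← pow_mul, ← pow_succ']
      exact this

/-- A dyadic Lieb–Thirring inequality. -/
lemma trace_mul_pow_two_pow_le (k : ℕ) {A B : Matrix n n ℝ} (hA : A.IsSymm) (hB : B.IsSymm) :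
    ((A * B) ^ 2 ^ k).trace ≤ (A ^ 2 ^ k * B ^ 2 ^ k).trace := by
  induction k generalizing A B with
  | zero => simp
  | succ k ih =>
    -- Hölder with all factors equal to `A * B`: by symmetry `(A * B) * (A * B)ᵀ = A * B ^ 2 * A`,
    -- whose powers have the traces of those of `A ^ 2 * B ^ 2`.
    have h1 := abs_trace_prod_le_of_dyadic k (c := ((A ^ 2 * B ^ 2) ^ 2 ^ k).trace)
      (fun _ => A * B) (fun _ => by
        rw [Matrix.transpose_mul, hA.eq, hB.eq, show A * B * (B * A) = (A * B ^ 2) * A by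
          simp only [Matrix.mul_assoc, sq], trace_mul_pow_comm, ← Matrix.mul_assoc, ← sq])
    rw [List.map_const', List.prod_replicate, List.length_range] at h1
    refine (le_abs_self _).trans (h1.trans ((ih (hA.pow 2) (hB.pow 2)).trans_eq ?_))
    rw [← pow_mul, ← pow_mul, ← pow_succ']

end Matrix

/-! ### The Lie–Trotter product formula. -/

section LieTrotter

open NormedSpace Filter Topology

variable {𝔸 : Type*} [NormedRing 𝔸] [NormedAlgebra ℝ 𝔸] [CompleteSpace 𝔸] [NormOneClass 𝔸]

omit [NormedAlgebra ℝ 𝔸] [CompleteSpace 𝔸] in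
lemma norm_pow_sub_pow_le_of_norm_le {x y : 𝔸} {r : ℝ} (hx : ‖x‖ ≤ r) (hy : ‖y‖ ≤ r) (k : ℕ) :
    ‖x ^ k - y ^ k‖ ≤ k * r ^ (k - 1) * ‖x - y‖ := by
  have hr : 0 ≤ r := (norm_nonneg x).trans hx
  induction k with
  | zero => simp
  | succ k ih =>
    have h1 : x ^ (k + 1) - y ^ (k + 1) = x * (x ^ k - y ^ k) + (x - y) * y ^ k := by
      rw [pow_succ', pow_succ']; noncomm_ring
    have h2 : ‖y ^ k‖ ≤ r ^ k := (norm_pow_le y k).trans (by gcongr)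
    have h3 : r * (k * r ^ (k - 1)) = k * r ^ k := by
      cases k with
      | zero => simp
      | succ k => simp; ring
    calc ‖x ^ (k + 1) - y ^ (k + 1)‖
        ≤ ‖x‖ * ‖x ^ k - y ^ k‖ + ‖x - y‖ * ‖y ^ k‖ := by
          rw [h1]
          exact (norm_add_le _ _).trans (add_le_add (norm_mul_le _ _) (norm_mul_le _ _))
      _ ≤ r * (k * r ^ (k - 1) * ‖x - y‖) + ‖x - y‖ * r ^ k := by gcongr
      _ = (k + 1 : ℕ) * r ^ (k + 1 - 1) * ‖x - y‖ := by
          rw [← mul_assoc, h3, Nat.add_sub_cancel]; push_cast; ring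

lemma norm_exp_le_exp_norm (x : 𝔸) : ‖exp x‖ ≤ Real.exp ‖x‖ := by
  have h := NormedSpace.exp_series_hasSum_exp' (𝕂 := ℝ) x
  have h2 := NormedSpace.exp_series_hasSum_exp' (𝕂 := ℝ) ‖x‖
  rw [← h.tsum_eq, Real.exp_eq_exp_ℝ, ← h2.tsum_eq]
  refine tsum_of_norm_bounded h2.summable.hasSum fun k => ?_
  rw [norm_smul, smul_eq_mul, Real.norm_of_nonneg (by positivity)]
  gcongr
  exact norm_pow_le x k

/-- The Lie–Trotter product formula. -/
theorem tendsto_exp_smul_mul_exp_smul_pow (a b : 𝔸) :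
    Tendsto (fun k : ℕ => (exp ((k : ℝ)⁻¹ • a) * exp ((k : ℝ)⁻¹ • b)) ^ k) atTop
      (𝓝 (exp (a + b))) := by
  let : NormedAlgebra ℚ 𝔸 := NormedAlgebra.restrictScalars ℚ ℝ 𝔸
  -- The two one-step factors agree to first order at `0`, so their distance at `1 / k` is `o(1 /
  -- k)`. This beats the factor `k` produced by telescoping the `k`-th powers.
  have hd : HasDerivAt (fun t : ℝ => exp (t • a) * exp (t • b) - exp (t • (a + b))) 0 0 := by
    have ha := hasDerivAt_exp_smul_const a (0 : ℝ)
    have hb := hasDerivAt_exp_smul_const b (0 : ℝ)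
    have hab := hasDerivAt_exp_smul_const (a + b) (0 : ℝ)
    refine ((ha.mul hb).sub hab).congr_deriv ?_
    simp
  have hslope : Tendsto (fun k : ℕ => (k : ℝ) *
      ‖exp ((k : ℝ)⁻¹ • a) * exp ((k : ℝ)⁻¹ • b) - exp ((k : ℝ)⁻¹ • (a + b))‖) atTop (𝓝 0) := by
    have h1 := hd.tendsto_slope.comp (tendsto_inv_atTop_nhdsGT_zero.mono_right
      (nhdsWithin_mono _ (fun x hx => ne_of_gt hx)) |>.comp tendsto_natCast_atTop_atTop)
    have h2 := h1.norm
    rw [norm_zero] at h2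
    refine h2.congr fun k => ?_
    simp [slope_def_module, norm_smul]
  rw [tendsto_iff_norm_sub_tendsto_zero]
  have hbound : ∀ᶠ k : ℕ in atTop,
      ‖(exp ((k : ℝ)⁻¹ • a) * exp ((k : ℝ)⁻¹ • b)) ^ k - exp (a + b)‖ ≤
      Real.exp (‖a‖ + ‖b‖) * ((k : ℝ) *
      ‖exp ((k : ℝ)⁻¹ • a) * exp ((k : ℝ)⁻¹ • b) - exp ((k : ℝ)⁻¹ • (a + b))‖) := by
    filter_upwards [eventually_ge_atTop 1] with k hk
    have hk0 : (k : ℝ) ≠ 0 := by positivity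
    have hexp : exp (a + b) = (exp ((k : ℝ)⁻¹ • (a + b))) ^ k := by
      rw [← NormedSpace.exp_nsmul, ← Nat.cast_smul_eq_nsmul ℝ, smul_smul, mul_inv_cancel₀ hk0,
        one_smul]
    have hx : ‖exp ((k : ℝ)⁻¹ • a) * exp ((k : ℝ)⁻¹ • b)‖ ≤
        Real.exp ((k : ℝ)⁻¹ * (‖a‖ + ‖b‖)) := by
      rw [mul_add, Real.exp_add]
      refine (norm_mul_le _ _).trans (mul_le_mul ?_ ?_ (norm_nonneg _) (Real.exp_pos _).le) <;>
      · refine (norm_exp_le_exp_norm _).trans_eq ?_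
        rw [norm_smul, Real.norm_of_nonneg (by positivity)]
    have hy : ‖exp ((k : ℝ)⁻¹ • (a + b))‖ ≤ Real.exp ((k : ℝ)⁻¹ * (‖a‖ + ‖b‖)) := by
      refine (norm_exp_le_exp_norm _).trans (Real.exp_le_exp.mpr ?_)
      rw [norm_smul, Real.norm_of_nonneg (by positivity)]
      gcongr
      exact norm_add_le a b
    have h := norm_pow_sub_pow_le_of_norm_le hx hy k
    have hr : Real.exp ((k : ℝ)⁻¹ * (‖a‖ + ‖b‖)) ^ (k - 1) ≤ Real.exp (‖a‖ + ‖b‖) := by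
      rw [← Real.exp_nat_mul, ← mul_assoc]
      refine Real.exp_le_exp.mpr (mul_le_of_le_one_left (by positivity) ?_)
      rw [← div_eq_mul_inv, div_le_one (by positivity)]
      exact_mod_cast Nat.sub_le k 1
    rw [hexp]
    refine h.trans ?_
    rw [mul_comm (k : ℝ), mul_assoc]
    gcongr
  refine squeeze_zero' (Eventually.of_forall fun _ => norm_nonneg _) hbound ?_
  simpa using hslope.const_mul (Real.exp (‖a‖ + ‖b‖))

end LieTrotter

/-! ### The Golden–Thompson inequality, from Lieb–Thirring and Lie–Trotter along `2 ^ k`. -/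

namespace Matrix

open NormedSpace Filter Topology

variable {n : Type*} [Fintype n] [DecidableEq n]

/-- The Golden–Thompson inequality for real symmetric matrices. -/
theorem trace_exp_add_le [Nonempty n] {A B : Matrix n n ℝ} (hA : A.IsSymm) (hB : B.IsSymm) :
    (exp (A + B)).trace ≤ (exp A * exp B).trace := by
  have h := (tendsto_exp_smul_mul_exp_smul_pow A B).comp
    (tendsto_pow_atTop_atTop_of_one_lt (one_lt_two (α := ℕ)))
  have hc : Continuous (fun M : Matrix n n ℝ => M.trace) :=
    (Matrix.traceLinearMap n ℝ ℝ).continuous_of_finiteDimensional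
  refine le_of_tendsto ((hc.tendsto _).comp h) (Eventually.of_forall fun k => ?_)
  have hs : ∀ M : Matrix n n ℝ, exp ((((2 ^ k : ℕ) : ℝ))⁻¹ • M) ^ 2 ^ k = exp M := fun M => by
    rw [← Matrix.exp_nsmul, ← Nat.cast_smul_eq_nsmul ℝ, smul_smul,
      mul_inv_cancel₀ (by positivity), one_smul]
  have := trace_mul_pow_two_pow_le k (hA.smul (((2 ^ k : ℕ) : ℝ))⁻¹).exp
    (hB.smul (((2 ^ k : ℕ) : ℝ))⁻¹).exp
  rw [hs, hs] at this
  exact this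

end Matrix

/-! ### Quadratic form bounds for matrix exponentials and for one step of the walk. -/

namespace Matrix

open NormedSpace Filter Topology

variable {n : Type*} [Fintype n] [DecidableEq n]

lemma norm_toLp_eq_sqrt {m : Type*} [Fintype m] (w : m → ℝ) :
    ‖WithLp.toLp 2 w‖ = Real.sqrt (w ⬝ᵥ w) := by
  rw [EuclideanSpace.norm_eq]
  simp [dotProduct, sq]

lemma abs_dotProduct_mulVec_le {m : Type*} [Fintype m] (M : Matrix m n ℝ) (u : m → ℝ) (v : n → ℝ) :
    |u ⬝ᵥ M *ᵥ v| ≤ ‖M‖ * (Real.sqrt (u ⬝ᵥ u) * Real.sqrt (v ⬝ᵥ v)) := by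
  have h1 := abs_real_inner_le_norm (WithLp.toLp 2 u) (WithLp.toLp 2 (M *ᵥ v))
  have h2 := Matrix.l2_opNorm_mulVec M (WithLp.toLp 2 v)
  have h3 : inner ℝ (WithLp.toLp 2 u) (WithLp.toLp 2 (M *ᵥ v)) = u ⬝ᵥ M *ᵥ v := by
    simp [EuclideanSpace.inner_eq_star_dotProduct, dotProduct_comm]
  rw [h3] at h1
  rw [← norm_toLp_eq_sqrt, ← norm_toLp_eq_sqrt]
  calc _ ≤ _ := h1
    _ ≤ ‖WithLp.toLp 2 u‖ * (‖M‖ * ‖WithLp.toLp 2 v‖) := by gcongr; exact h2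
    _ = _ := by ring

lemma dotProduct_mulVec_le_norm (M : Matrix n n ℝ) (v : n → ℝ) :
    v ⬝ᵥ M *ᵥ v ≤ ‖M‖ * (v ⬝ᵥ v) := by
  have := (le_abs_self _).trans (abs_dotProduct_mulVec_le M v v)
  rwa [Real.mul_self_sqrt (by simpa using dotProduct_star_self_nonneg v)] at this

lemma IsSymm.exp_eq_mul_self {H : Matrix n n ℝ} (hH : H.IsSymm) :
    ∃ R : Matrix n n ℝ, R.IsSymm ∧ NormedSpace.exp H = R * R := by
  refine ⟨NormedSpace.exp ((2 : ℝ)⁻¹ • H), (hH.smul _).exp, ?_⟩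
  rw [← Matrix.exp_add_of_commute _ _ (Commute.refl _), ← add_smul]
  norm_num

/-- Writing `exp H = R * R` with `R` symmetric turns the trace into a sum of the forms of `M` at the
columns of `R`. No symmetry of `M` is required. -/
lemma trace_exp_mul_le {H M : Matrix n n ℝ} (hH : H.IsSymm) {κ : ℝ}
    (hM : ∀ v, v ⬝ᵥ M *ᵥ v ≤ κ * (v ⬝ᵥ v)) :
    (exp H * M).trace ≤ κ * (exp H).trace := by
  obtain ⟨R, hR, hexp⟩ := hH.exp_eq_mul_self
  have h1 : (exp H * M).trace = ∑ i, Rᵀ i ⬝ᵥ M *ᵥ Rᵀ i := by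
    have : (exp H * M).trace = (Rᵀ * (M * R)).trace := by
      rw [hexp, hR.eq, Matrix.mul_assoc, Matrix.trace_mul_comm, Matrix.mul_assoc]
    rw [this]
    simp [Matrix.trace, Matrix.mul_apply, dotProduct, mulVec]
  have h2 : (exp H).trace = ∑ i, Rᵀ i ⬝ᵥ Rᵀ i := by
    rw [hexp]
    nth_rewrite 1 [← hR.eq]
    simp [Matrix.trace, Matrix.mul_apply, dotProduct]
  rw [h1, h2, Finset.mul_sum]
  exact Finset.sum_le_sum fun i _ => hM _

lemma trace_exp_nonneg {H : Matrix n n ℝ} (hH : H.IsSymm) : 0 ≤ (exp H).trace := by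
  obtain ⟨R, hR, hexp⟩ := hH.exp_eq_mul_self
  rw [hexp]
  nth_rewrite 1 [← hR.eq]
  simp only [Matrix.trace, Matrix.diag_apply, Matrix.mul_apply, Matrix.transpose_apply]
  exact Finset.sum_nonneg fun i _ => Finset.sum_nonneg fun j _ => mul_self_nonneg _

/-- Each term of the series from order two on equals, up to its factorial, the form of `A ^ k` at `A
*ᵥ v`, hence is at most `r ^ k` times the form of `A * A`. The factorials are compared with a
geometric series of ratio `1 / 3`, the source of the `3` in Bernstein's denominator. -/
lemma IsSymm.dotProduct_exp_mulVec_le [Nonempty n] {A : Matrix n n ℝ} (hA : A.IsSymm) {r : ℝ} (hr : ‖A‖ ≤ r)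
    (hr3 : r < 3) (v : n → ℝ) :
    v ⬝ᵥ (NormedSpace.exp A - 1 - A) *ᵥ v ≤ (1 / 2) / (1 - r / 3) * (v ⬝ᵥ (A * A) *ᵥ v) := by
  have hr0 : 0 ≤ r := (norm_nonneg A).trans hr
  have hs := NormedSpace.exp_series_hasSum_exp' (𝕂 := ℝ) A
  have hs2 : HasSum (fun k : ℕ => (((k + 2).factorial : ℝ)⁻¹) • A ^ (k + 2))
      (NormedSpace.exp A - 1 - A) := by
    have := (hasSum_nat_add_iff' 2).mpr hs
    simpa [Finset.sum_range_succ, sub_sub] using this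
  let φ : Matrix n n ℝ →ₗ[ℝ] ℝ :=
    { toFun := fun M => v ⬝ᵥ M *ᵥ v
      map_add' := fun M N => by simp [add_mulVec, dotProduct_add]
      map_smul' := fun c M => by simp [smul_mulVec, dotProduct_smul] }
  have hφ := hs2.mapL (LinearMap.toContinuousLinearMap φ)
  have hg : HasSum (fun k : ℕ => ((1 / 2) * (v ⬝ᵥ (A * A) *ᵥ v)) * (r / 3) ^ k)
      (((1 / 2) * (v ⬝ᵥ (A * A) *ᵥ v)) * (1 - r / 3)⁻¹) :=
    (hasSum_geometric_of_lt_one (by positivity) (by linarith)).mul_left _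
  have hAA : v ⬝ᵥ (A * A) *ᵥ v = (A *ᵥ v) ⬝ᵥ (A *ᵥ v) := by
    rw [← mulVec_mulVec, dotProduct_mulVec, ← mulVec_transpose, hA.eq]
  have hAA0 : 0 ≤ v ⬝ᵥ (A * A) *ᵥ v := by
    rw [hAA]; simpa using dotProduct_star_self_nonneg (A *ᵥ v)
  have h := hasSum_le (fun k => ?_) hφ hg
  · calc _ ≤ _ := h
      _ = _ := by rw [div_eq_mul_inv]; ring
  · change φ ((((k + 2).factorial : ℝ)⁻¹) • A ^ (k + 2)) ≤ _
    rw [map_smul, smul_eq_mul]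
    have h1 : φ (A ^ (k + 2)) ≤ r ^ k * (v ⬝ᵥ (A * A) *ᵥ v) := by
      change v ⬝ᵥ (A ^ (k + 2)) *ᵥ v ≤ _
      have : v ⬝ᵥ (A ^ (k + 2)) *ᵥ v = (A *ᵥ v) ⬝ᵥ (A ^ k) *ᵥ (A *ᵥ v) := by
        rw [show A ^ (k + 2) = A * (A ^ k * A) by
            rw [pow_succ, pow_succ', Matrix.mul_assoc],
          ← mulVec_mulVec, dotProduct_mulVec, ← mulVec_transpose, hA.eq, ← mulVec_mulVec]
      rw [this, hAA]
      refine (dotProduct_mulVec_le_norm _ _).trans ?_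
      rw [hAA] at hAA0
      gcongr
      exact ((norm_pow_le A k)).trans (by gcongr)
    have h2 : (((k + 2).factorial : ℝ)⁻¹) ≤ (1 / 2) * (1 / 3) ^ k := by
      have : 2 * 3 ^ k ≤ (k + 2).factorial := by
        have := Nat.factorial_mul_pow_le_factorial (m := 2) (n := k)
        simpa [add_comm] using this
      have h' : (2 * 3 ^ k : ℝ) ≤ (k + 2).factorial := by exact_mod_cast this
      calc (((k + 2).factorial : ℝ)⁻¹) ≤ (2 * 3 ^ k : ℝ)⁻¹ := by gcongr
        _ = _ := by simp [mul_comm]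
    calc _ ≤ ((1 / 2) * (1 / 3) ^ k) * (r ^ k * (v ⬝ᵥ (A * A) *ᵥ v)) := by
          refine (mul_le_mul_of_nonneg_left h1 (by positivity)).trans ?_
          gcongr
      _ = _ := by rw [div_pow, div_pow]; ring


omit [DecidableEq n] in
lemma dotProduct_sum_mulVec {J : Type*} (s : Finset J) (M : J → Matrix n n ℝ) (v : n → ℝ) :
    v ⬝ᵥ (∑ j ∈ s, M j) *ᵥ v = ∑ j ∈ s, v ⬝ᵥ M j *ᵥ v := by
  classical
  induction s using Finset.induction_on with
  | empty => simp
  | insert a s ha ih => rw [Finset.sum_insert ha, Finset.sum_insert ha, add_mulVec,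
      dotProduct_add, ih]

/-- The moment generating matrix of one step of the compensated random walk that approximates a
compound Poisson variable. -/
noncomputable def stepMGF {J : Type*} [Fintype J] (lam : J → ℝ) (A : J → Matrix n n ℝ) (h : ℝ) :
    Matrix n n ℝ :=
  (1 - h * ∑ j, lam j) • exp (-h • ∑ j, lam j • A j) +
    h • ∑ j, lam j • exp (A j - h • ∑ i, lam i • A i)

lemma hasDerivAt_stepMGF [Nonempty n] {J : Type*} [Fintype J] (lam : J → ℝ)
    (A : J → Matrix n n ℝ) :
    HasDerivAt (stepMGF lam A) (∑ j, lam j • (exp (A j) - 1 - A j)) 0 := by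
  set B := ∑ j, lam j • A j with hB
  have h1 : HasDerivAt (fun h : ℝ => exp (-h • B)) (-B) 0 := by
    have := (hasDerivAt_exp_smul_const (𝕂 := ℝ) (-B) 0)
    simpa using this
  have h2 : HasDerivAt (fun h : ℝ => 1 - h * ∑ j, lam j) (-∑ j, lam j) 0 := by
    simpa using ((hasDerivAt_id (0 : ℝ)).mul_const (∑ j, lam j)).const_sub 1
  -- Differentiability is enough: in the product rule this derivative is multiplied by `h = 0`, and
  -- only the value at `0` survives.
  have h3 : DifferentiableAt ℝ (fun h : ℝ => ∑ j, lam j • exp (A j - h • B)) 0 := by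
    refine DifferentiableAt.fun_sum fun j _ => DifferentiableAt.fun_const_smul ?_ _
    have he : DifferentiableAt ℝ (exp : Matrix n n ℝ → Matrix n n ℝ) (A j - (0 : ℝ) • B) :=
      (NormedSpace.exp_analytic (𝕂 := ℝ) _).differentiableAt
    exact he.comp (0 : ℝ) (by fun_prop)
  have h4 := (h2.smul h1).add ((hasDerivAt_id (0 : ℝ)).smul h3.hasDerivAt)
  refine h4.congr_deriv ?_
  simp [smul_sub, Finset.sum_sub_distrib, ← Finset.sum_smul, ← hB]
  abel

/-- First-order expansion at `0`, where `stepMGF` is the identity. The remainder is `o(h)` in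
operator norm, so `ε` absorbs it uniformly in `v`. -/
lemma eventually_stepMGF_le [Nonempty n] {J : Type*} [Fintype J] {lam : J → ℝ}
    {A : J → Matrix n n ℝ} {κ ε : ℝ} (hε : 0 < ε)
    (hκ : ∀ v, v ⬝ᵥ (∑ j, lam j • (exp (A j) - 1 - A j)) *ᵥ v ≤ κ * (v ⬝ᵥ v)) :
    ∀ᶠ h in 𝓝[>] (0 : ℝ), ∀ v, v ⬝ᵥ stepMGF lam A h *ᵥ v ≤ (1 + h * (κ + ε)) * (v ⬝ᵥ v) := by
  set K := ∑ j, lam j • (exp (A j) - 1 - A j) with hK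
  have h1 := (hasDerivAt_stepMGF lam A).tendsto_slope.mono_left
    (nhdsWithin_mono (0 : ℝ) (fun x (hx : 0 < x) => ne_of_gt hx))
  have h2 := (tendsto_iff_norm_sub_tendsto_zero.mp h1).eventually (gt_mem_nhds hε)
  filter_upwards [h2, self_mem_nhdsWithin] with h hh hpos v
  have hpos : 0 < h := hpos
  set E := slope (stepMGF lam A) 0 h - K with hE
  have h3 : stepMGF lam A h = 1 + h • K + h • E := by
    have h0 : stepMGF lam A 0 = 1 := by simp [stepMGF]
    rw [hE, slope_def_module, h0, sub_zero, smul_sub, smul_smul, mul_inv_cancel₀ hpos.ne', one_smul]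
    abel
  have h4 := dotProduct_mulVec_le_norm E v
  have h5 : 0 ≤ v ⬝ᵥ v := by simpa using dotProduct_star_self_nonneg v
  have h6 : v ⬝ᵥ E *ᵥ v ≤ ε * (v ⬝ᵥ v) := h4.trans (by gcongr)
  rw [h3]
  simp only [add_mulVec, dotProduct_add, smul_mulVec, dotProduct_smul, one_mulVec, smul_eq_mul]
  nlinarith [mul_le_mul_of_nonneg_left (hκ v) hpos.le, mul_le_mul_of_nonneg_left h6 hpos.le]

end Matrix

/-! ### Laws of random walks as elements of a commutative convolution algebra. -/

section Translation

variable {G : Type*} [AddCommMonoid G]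

/-- The action of the additive monoid algebra on functions by translation. -/
noncomputable def translationHom (G : Type*) [AddCommMonoid G] :
    AddMonoidAlgebra ℝ G →ₐ[ℝ] Module.End ℝ (G → ℝ) :=
  AddMonoidAlgebra.lift ℝ (Module.End ℝ (G → ℝ)) G
    { toFun := fun c => LinearMap.funLeft ℝ ℝ (fun x => x + c.toAdd)
      map_one' := by ext g x; simp
      map_mul' := fun a b => by
        ext g x
        simp [LinearMap.funLeft_apply, add_assoc] }

lemma translationHom_single (c : G) (p : ℝ) (g : G → ℝ) (x : G) :
    translationHom G (AddMonoidAlgebra.single c p) g x = p * g (x + c) := by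
  simp [translationHom, LinearMap.funLeft_apply]

/-- The multinomial theorem in the commutative algebra: it passes from the law of `m` successive
jumps to the vector `k` counting the jumps of each kind. -/
lemma translationHom_sum_pow {J : Type*} [Fintype J] [DecidableEq J] (lam : J → ℝ) (A : J → G)
    (g : G → ℝ) (x : G) (m : ℕ) :
    translationHom G ((∑ j, AddMonoidAlgebra.single (A j) (lam j)) ^ m) g x =
      ∑ k ∈ Finset.piAntidiag Finset.univ m,
        (Nat.multinomial Finset.univ k * ∏ j, lam j ^ k j) * g (x + ∑ j, k j • A j) := by
  have hprod : ∀ k : J → ℕ, ∏ j, (AddMonoidAlgebra.single (A j) (lam j)) ^ k j =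
      AddMonoidAlgebra.single (∑ j, k j • A j) (∏ j, lam j ^ k j) := fun k => by
    simp only [AddMonoidAlgebra.single_pow]
    generalize (Finset.univ : Finset J) = s
    induction s using Finset.induction_on with
    | empty => simp [AddMonoidAlgebra.one_def]
    | insert a s ha ih =>
      rw [Finset.prod_insert ha, ih, AddMonoidAlgebra.single_mul_single, Finset.sum_insert ha,
        Finset.prod_insert ha]
  rw [Finset.sum_pow_eq_sum_piAntidiag, map_sum, LinearMap.sum_apply, Finset.sum_apply]
  refine Finset.sum_congr rfl fun k _ => ?_
  rw [hprod, ← nsmul_eq_mul, map_nsmul, LinearMap.smul_apply, Pi.smul_apply, translationHom_single]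
  simp [mul_assoc]

/-- If one step of a random walk increases a function by at most a factor `κ` on an invariant set,
then `m` steps increase it by at most `κ ^ m`. -/
lemma translationHom_pow_le {J : Type*} [Fintype J] {p : J → ℝ} (hp : ∀ j, 0 ≤ p j) {C : J → G}
    {g : G → ℝ} {κ : ℝ} (hκ : 0 ≤ κ) {S : Set G} (hS : ∀ x ∈ S, ∀ j, x + C j ∈ S)
    (hstep : ∀ x ∈ S, ∑ j, p j * g (x + C j) ≤ κ * g x) (m : ℕ) :
    ∀ x ∈ S, translationHom G ((∑ j, AddMonoidAlgebra.single (C j) (p j)) ^ m) g x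
      ≤ κ ^ m * g x := by
  induction m with
  | zero => intro x _; simp
  | succ m ih =>
    intro x hx
    rw [pow_succ', map_mul, Module.End.mul_apply, map_sum, LinearMap.sum_apply, Finset.sum_apply]
    simp only [translationHom_single]
    calc _ ≤ ∑ j, p j * (κ ^ m * g (x + C j)) :=
          Finset.sum_le_sum fun j _ => mul_le_mul_of_nonneg_left (ih _ (hS x hx j)) (hp j)
      _ = κ ^ m * ∑ j, p j * g (x + C j) := by
          rw [Finset.mul_sum]; exact Finset.sum_congr rfl fun j _ => by ring
      _ ≤ κ ^ m * (κ * g x) := mul_le_mul_of_nonneg_left (hstep x hx) (pow_nonneg hκ m)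
      _ = _ := by ring

end Translation

/-! ### The trace exponential moment of a compensated compound Poisson matrix. -/

namespace Matrix

open NormedSpace Filter Topology

variable {n : Type*} [Fintype n] [DecidableEq n]

omit [Fintype n] [DecidableEq n] in
lemma isSymm_sum {J : Type*} (s : Finset J) {A : J → Matrix n n ℝ} (hA : ∀ j, (A j).IsSymm) :
    (∑ j ∈ s, A j).IsSymm := by
  rw [Matrix.IsSymm, Matrix.transpose_sum]
  exact Finset.sum_congr rfl fun j _ => (hA j).eq

/-- Bound for the trace exponential moment, expanded over the number `m` of jumps among `r` steps of the compensated random walk. -/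
lemma sum_choose_mul_translationHom_le [Nonempty n] {J : Type*} [Fintype J]
    {lam : J → ℝ} (hlam : ∀ j, 0 ≤ lam j) {A : J → Matrix n n ℝ} (hA : ∀ j, (A j).IsSymm)
    {r : ℕ} (hr : 0 < r) (hr1 : (r : ℝ)⁻¹ * ∑ j, lam j ≤ 1) {c : ℝ} (hc : 0 ≤ c)
    (hstep : ∀ v, v ⬝ᵥ stepMGF lam A (r : ℝ)⁻¹ *ᵥ v ≤ c * (v ⬝ᵥ v)) :
    ∑ m ∈ Finset.range (r + 1), (r.choose m * (r : ℝ)⁻¹ ^ m *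
        (1 - (r : ℝ)⁻¹ * ∑ j, lam j) ^ (r - m)) *
      translationHom (Matrix n n ℝ) ((∑ j, AddMonoidAlgebra.single (A j) (lam j)) ^ m)
        (fun H => (exp H).trace) (- ∑ j, lam j • A j)
      ≤ c ^ r * Fintype.card n := by
  set B := ∑ j, lam j • A j with hB
  set Λ := ∑ j, lam j with hΛ
  set h := (r : ℝ)⁻¹ with hh
  have hBs : B.IsSymm := isSymm_sum _ fun j => (hA j).smul _
  have h0 : 0 ≤ h := by positivity
  set ν := ∑ j, AddMonoidAlgebra.single (A j) (lam j) with hν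
  set f : Matrix n n ℝ → ℝ := fun H => (exp H).trace with hf
  let p : Option J → ℝ := fun o => o.elim (1 - h * Λ) fun j => h * lam j
  let C : Option J → Matrix n n ℝ := fun o => o.elim (-(h • B)) fun j => A j - h • B
  have hCs : ∀ o, (C o).IsSymm := fun o => by
    cases o with
    | none => exact (hBs.smul h).neg
    | some j => exact (hA j).sub (hBs.smul h)
  have hp : ∀ o, 0 ≤ p o := fun o => by
    cases o with
    | none => simpa [p] using hr1
    | some j => exact mul_nonneg h0 (hlam j)
  -- The outcome `none` of a step is pure drift, `some j` a jump by `A j` plus drift. The walk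
  -- starts at `0`, where `f` is the dimension, and stays among symmetric matrices, as
  -- Golden–Thompson requires.
  have hwalk := translationHom_pow_le hp hc (S := {H | H.IsSymm}) (C := C) (g := f)
    (fun x hx j => hx.add (hCs j)) (fun H hH => ?_) r 0 Matrix.isSymm_zero
  · have hμ : ∑ o, AddMonoidAlgebra.single (C o) (p o) =
        (h • ν + algebraMap ℝ _ (1 - h * Λ)) * AddMonoidAlgebra.single (-(h • B)) 1 := by
      rw [Fintype.sum_option, add_mul, add_comm, hν, Finset.smul_sum, Finset.sum_mul]
      congr 1
      · refine Finset.sum_congr rfl fun j _ => ?_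
        rw [AddMonoidAlgebra.smul_single, AddMonoidAlgebra.single_mul_single]
        simp [p, C, sub_eq_add_neg]
      · rw [Algebra.algebraMap_eq_smul_one, AddMonoidAlgebra.one_def,
          AddMonoidAlgebra.smul_single, AddMonoidAlgebra.single_mul_single]
        simp [p, C]
    have hexp : (∑ o, AddMonoidAlgebra.single (C o) (p o)) ^ r =
        ∑ m ∈ Finset.range (r + 1), (r.choose m * h ^ m * (1 - h * Λ) ^ (r - m)) •
          (AddMonoidAlgebra.single (-B) 1 * ν ^ m) := by
      rw [hμ, mul_pow, AddMonoidAlgebra.single_pow, one_pow, smul_neg, ← Nat.cast_smul_eq_nsmul ℝ,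
        smul_smul, hh, mul_inv_cancel₀ (by positivity), one_smul, add_pow, Finset.sum_mul]
      refine Finset.sum_congr rfl fun m _ => ?_
      rw [smul_pow, ← map_pow, Algebra.smul_def, Algebra.smul_def]
      simp only [map_mul, map_natCast]
      ring
    rw [hexp, map_sum, LinearMap.sum_apply, Finset.sum_apply] at hwalk
    refine (Finset.sum_le_sum fun m _ => le_of_eq ?_).trans (hwalk.trans_eq ?_)
    · rw [map_smul, map_mul, LinearMap.smul_apply, Module.End.mul_apply, Pi.smul_apply,
        translationHom_single, smul_eq_mul, one_mul, zero_add]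
    · simp [hf]
  · have hH : H.IsSymm := hH
    calc ∑ o, p o * f (H + C o) ≤ ∑ o, p o * (exp H * exp (C o)).trace :=
          Finset.sum_le_sum fun o _ =>
            mul_le_mul_of_nonneg_left (trace_exp_add_le hH (hCs o)) (hp o)
      _ = (exp H * stepMGF lam A h).trace := by
          have hM : stepMGF lam A h = (1 - h * Λ) • exp (-(h • B)) +
              h • ∑ j, lam j • exp (A j - h • B) := by
            simp only [stepMGF, neg_smul, hB, hΛ]
          rw [Fintype.sum_option, hM, Matrix.mul_add, Matrix.trace_add, Matrix.mul_smul,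
            Matrix.trace_smul, Matrix.mul_smul, Matrix.trace_smul, Matrix.mul_sum,
            Matrix.trace_sum]
          simp [p, C, mul_assoc, Finset.mul_sum]
      _ ≤ c * f H := trace_exp_mul_le hH hstep

/-- The Poisson limit of binomial weights. The power `Λ ^ m` is absent because the unnormalized jump
measure, of mass `Λ`, carries it in its `m`-th power. -/
lemma tendsto_choose_mul_inv_pow_mul (Λ : ℝ) (m : ℕ) :
    Tendsto (fun r : ℕ => (r.choose m * (r : ℝ)⁻¹ ^ m * (1 - (r : ℝ)⁻¹ * Λ) ^ (r - m)))
      atTop (𝓝 (Real.exp (-Λ) / m.factorial)) := by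
  have h1 := ProbabilityTheory.tendsto_choose_mul_pow_atTop (p := fun r : ℕ => (r : ℝ)⁻¹) (r := 1) m
    (tendsto_const_nhds.congr' (by
      filter_upwards [eventually_ge_atTop 1] with r hr
      rw [mul_inv_cancel₀ (by positivity)]))
  have h2 := Real.tendsto_one_add_div_pow_exp (-Λ)
  have hinv : Tendsto (fun r : ℕ => 1 - (r : ℝ)⁻¹ * Λ) atTop (𝓝 1) := by
    simpa using ((tendsto_inv_atTop_nhds_zero_nat (𝕜 := ℝ)).mul_const Λ).const_sub 1
  have h3 := (h2.div (hinv.pow m) (by simp))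
  refine ((h1.mul h3).congr' ?_).trans_eq (by simp; ring_nf)
  filter_upwards [eventually_ge_atTop m, hinv.eventually (lt_mem_nhds one_pos)] with r hr hpos
  have : (1 + -Λ / r) = 1 - (r : ℝ)⁻¹ * Λ := by ring
  simp only [Pi.div_apply]
  rw [this, pow_sub₀ _ hpos.ne' hr, div_eq_mul_inv]

/-- All terms are nonnegative, so truncating the walk bound at `M` jumps keeps it valid and leaves a
fixed finite sum. There `r → ∞` is taken termwise, while `(1 + (κ + ε) / r) ^ r` tends to `exp (κ +
ε)`; then `ε → 0`. -/
theorem sum_translationHom_le_exp [Nonempty n] {J : Type*} [Fintype J] [DecidableEq J]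
    {lam : J → ℝ} (hlam : ∀ j, 0 ≤ lam j) {A : J → Matrix n n ℝ} (hA : ∀ j, (A j).IsSymm)
    {κ : ℝ} (hκ : ∀ v, v ⬝ᵥ (∑ j, lam j • (exp (A j) - 1 - A j)) *ᵥ v ≤ κ * (v ⬝ᵥ v)) (M : ℕ) :
    ∑ m ∈ Finset.range M, Real.exp (-∑ j, lam j) / m.factorial *
      translationHom (Matrix n n ℝ) ((∑ j, AddMonoidAlgebra.single (A j) (lam j)) ^ m)
        (fun H => (exp H).trace) (- ∑ j, lam j • A j)
      ≤ Real.exp κ * Fintype.card n := by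
  set Λ := ∑ j, lam j with hΛ
  have hBs : (-∑ j, lam j • A j).IsSymm := (isSymm_sum _ fun j => (hA j).smul _).neg
  have hnonneg : ∀ m, 0 ≤ translationHom (Matrix n n ℝ)
      ((∑ j, AddMonoidAlgebra.single (A j) (lam j)) ^ m)
        (fun H => (exp H).trace) (- ∑ j, lam j • A j) := fun m => by
    rw [translationHom_sum_pow]
    refine Finset.sum_nonneg fun k _ => mul_nonneg (mul_nonneg (by positivity)
      (Finset.prod_nonneg fun j _ => pow_nonneg (hlam j) _)) (trace_exp_nonneg ?_)
    exact hBs.add (isSymm_sum _ fun j => (hA j).smul _)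
  have key : ∀ ε > 0, ∑ m ∈ Finset.range M, Real.exp (-Λ) / m.factorial *
      translationHom (Matrix n n ℝ) ((∑ j, AddMonoidAlgebra.single (A j) (lam j)) ^ m)
        (fun H => (exp H).trace) (- ∑ j, lam j • A j)
      ≤ Real.exp (κ + ε) * Fintype.card n := by
    intro ε hε
    have hlim := tendsto_finsetSum (Finset.range M) fun m _ =>
      (tendsto_choose_mul_inv_pow_mul Λ m).mul_const (translationHom (Matrix n n ℝ)
        ((∑ j, AddMonoidAlgebra.single (A j) (lam j)) ^ m)
        (fun H => (exp H).trace) (- ∑ j, lam j • A j))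
    have hlim2 := (Real.tendsto_one_add_div_pow_exp (κ + ε)).mul_const (Fintype.card n : ℝ)
    refine le_of_tendsto_of_tendsto hlim hlim2 ?_
    have hinv : Tendsto (fun r : ℕ => (r : ℝ)⁻¹) atTop (𝓝[>] 0) :=
      tendsto_inv_atTop_nhdsGT_zero.comp tendsto_natCast_atTop_atTop
    have e1 : ∀ᶠ h : ℝ in 𝓝[>] 0, h * Λ ≤ 1 := nhdsWithin_le_nhds
      (((continuous_id.mul continuous_const).tendsto' 0 0 (by simp)).eventually
        (ge_mem_nhds one_pos))
    have e2 : ∀ᶠ h : ℝ in 𝓝[>] 0, 0 ≤ 1 + h * (κ + ε) := nhdsWithin_le_nhds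
      (((continuous_const.add (continuous_id.mul continuous_const)).tendsto' 0 1
        (by simp)).eventually (le_mem_nhds one_pos))
    filter_upwards [eventually_ge_atTop 1, eventually_ge_atTop M, hinv.eventually e1,
      hinv.eventually e2, hinv.eventually (eventually_stepMGF_le hε hκ)] with r hr hM hr1 hr2 hstep
    have := sum_choose_mul_translationHom_le hlam hA hr hr1 hr2 hstep
    rw [show 1 + (κ + ε) / r = 1 + (r : ℝ)⁻¹ * (κ + ε) by ring]
    refine le_trans (Finset.sum_le_sum_of_subset_of_nonneg
      (Finset.range_subset_range.mpr (by omega)) fun m _ _ => mul_nonneg ?_ (hnonneg m)) this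
    have : 0 ≤ 1 - (r : ℝ)⁻¹ * Λ := by linarith
    positivity
  have hlim : Tendsto (fun ε : ℝ => Real.exp (κ + ε) * Fintype.card n) (𝓝[>] 0)
      (𝓝 (Real.exp κ * Fintype.card n)) := by
    refine Tendsto.mono_left ?_ nhdsWithin_le_nhds
    exact Continuous.tendsto' (by fun_prop) _ _ (by simp)
  exact ge_of_tendsto hlim (by filter_upwards [self_mem_nhdsWithin] with ε hε using key ε hε)

/-- The trace exponential moment of a compensated matrix compound Poisson variable. -/
theorem sum_prod_poisson_mul_trace_exp_le [Nonempty n] {J : Type*} [Fintype J] [DecidableEq J]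
    {lam : J → ℝ} (hlam : ∀ j, 0 ≤ lam j) {A : J → Matrix n n ℝ} (hA : ∀ j, (A j).IsSymm)
    {κ : ℝ} (hκ : ∀ v, v ⬝ᵥ (∑ j, lam j • (exp (A j) - 1 - A j)) *ᵥ v ≤ κ * (v ⬝ᵥ v))
    (K : Finset (J → ℕ)) :
    ∑ k ∈ K, (∏ j, Real.exp (-lam j) * lam j ^ k j / (k j).factorial) *
      (exp (∑ j, k j • A j - ∑ j, lam j • A j)).trace ≤ Real.exp κ * Fintype.card n := by
  set B := ∑ j, lam j • A j with hB
  have hBs : B.IsSymm := isSymm_sum _ fun j => (hA j).smul _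
  set t : (J → ℕ) → ℝ := fun k => (∏ j, Real.exp (-lam j) * lam j ^ k j / (k j).factorial) *
      (exp (∑ j, k j • A j - B)).trace with ht
  have hnonneg : ∀ k, 0 ≤ t k := fun k => by
    refine mul_nonneg (Finset.prod_nonneg fun j _ => ?_) (trace_exp_nonneg ?_)
    · have := hlam j; positivity
    · exact (isSymm_sum _ fun j => (hA j).smul _).sub hBs
  obtain ⟨M, hM⟩ : ∃ M, ∀ k ∈ K, ∑ j, k j < M :=
    ⟨K.sup (fun k => ∑ j, k j) + 1, fun k hk =>
      Nat.lt_succ_of_le (Finset.le_sup (f := fun k : J → ℕ => ∑ j, k j) hk)⟩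
  have h := sum_translationHom_le_exp hlam hA hκ M
  have hsub : ∑ k ∈ K, t k ≤ ∑ m ∈ Finset.range M, ∑ k ∈ Finset.piAntidiag Finset.univ m, t k := by
    rw [Finset.sum_sigma']
    rw [← Finset.sum_image (s := (Finset.range M).sigma fun m => Finset.piAntidiag Finset.univ m)
      (g := fun x : (_ : ℕ) × (J → ℕ) => x.2) (f := t)]
    · refine Finset.sum_le_sum_of_subset_of_nonneg (fun k hk => ?_) fun k _ _ => hnonneg k
      simp only [Finset.mem_image, Finset.mem_sigma, Finset.mem_range, Finset.mem_piAntidiag]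
      exact ⟨⟨∑ j, k j, k⟩, ⟨hM k hk, rfl, by simp⟩, rfl⟩
    · rintro ⟨a, k⟩ hx ⟨b, l⟩ hy (rfl : k = l)
      simp only [Finset.coe_sigma, Set.mem_sigma_iff, Finset.mem_coe,
        Finset.mem_piAntidiag] at hx hy
      rw [← hx.2.1, ← hy.2.1]
  refine hsub.trans (le_trans (Finset.sum_le_sum fun m _ => le_of_eq ?_) h)
  rw [translationHom_sum_pow, Finset.mul_sum]
  refine Finset.sum_congr rfl fun k hk => ?_
  rw [Finset.mem_piAntidiag] at hk
  -- Independent Poisson counts have a Poisson total and, given the total, a multinomial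
  -- distribution.
  have h1 : ∏ j, Real.exp (-lam j) * lam j ^ k j / (k j).factorial =
      Real.exp (-∑ j, lam j) / m.factorial * (Nat.multinomial Finset.univ k * ∏ j, lam j ^ k j) := by
    have h2 := Nat.multinomial_spec Finset.univ k
    have h3 : ((∏ j, (k j).factorial : ℕ) : ℝ) * Nat.multinomial Finset.univ k = m.factorial := by
      rw [← hk.1]; exact_mod_cast h2
    have h4 : ((∏ j, (k j).factorial : ℕ) : ℝ) ≠ 0 := by
      exact_mod_cast (Finset.prod_pos fun j _ => Nat.factorial_pos _).ne'
    rw [Finset.prod_div_distrib, Finset.prod_mul_distrib, ← Real.exp_sum, ← h3,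
      Finset.sum_neg_distrib]
    have h5 : (Nat.multinomial Finset.univ k : ℝ) ≠ 0 := by
      exact_mod_cast (Nat.multinomial_pos _ _).ne'
    push_cast at h4 ⊢
    field_simp
  simp only [ht]
  rw [h1, neg_add_eq_sub, mul_assoc]

end Matrix

/-! ### Self-adjoint dilation: from rectangular matrices to symmetric ones. -/

namespace Matrix

open NormedSpace

section

variable {n : Type*} [Fintype n] [DecidableEq n]

lemma IsHermitian.trace_exp_smul {A : Matrix n n ℝ} (hA : A.IsHermitian) (c : ℝ) :
    (NormedSpace.exp (c • A)).trace = ∑ i, Real.exp (c * hA.eigenvalues i) := by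
  have hs : c • A = (Unitary.toUnits hA.eigenvectorUnitary : Matrix n n ℝ) *
      diagonal (fun i => c * hA.eigenvalues i) *
      ((Unitary.toUnits hA.eigenvectorUnitary)⁻¹ : (Matrix n n ℝ)ˣ) := by
    conv_lhs => rw [hA.spectral_theorem, Unitary.conjStarAlgAut_apply]
    rw [← Matrix.smul_mul, ← Matrix.mul_smul, ← diagonal_smul]
    rfl
  rw [hs, Matrix.exp_units_conj, Matrix.trace_mul_comm, ← Matrix.mul_assoc, Units.inv_mul,
    Matrix.one_mul]
  simp [Matrix.exp_diagonal, Matrix.trace, Real.exp_eq_exp_ℝ]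

lemma IsHermitian.exists_abs_eigenvalues_ge_norm [Nonempty n] {A : Matrix n n ℝ}
    (hA : A.IsHermitian) : ∃ i, ‖A‖ ≤ |hA.eigenvalues i| := by
  obtain ⟨i, -, hi⟩ := Finset.exists_max_image Finset.univ (fun i => |hA.eigenvalues i|)
    Finset.univ_nonempty
  refine ⟨i, ?_⟩
  conv_lhs => rw [hA.spectral_theorem]
  rw [Unitary.conjStarAlgAut_apply, CStarRing.norm_mul_mem_unitary _
    (Unitary.star_mem hA.eigenvectorUnitary.2), CStarRing.norm_coe_unitary_mul, l2_opNorm_diagonal]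
  refine (pi_norm_le_iff_of_nonneg (abs_nonneg _)).mpr fun j => ?_
  simpa using hi j (Finset.mem_univ j)

end

variable {m n : Type*} [Fintype m] [DecidableEq m] [Fintype n] [DecidableEq n]

/-- The self-adjoint dilation of a rectangular matrix. -/
def dilation (S : Matrix m n ℝ) : Matrix (m ⊕ n) (m ⊕ n) ℝ := fromBlocks 0 S Sᵀ 0

omit [Fintype m] [DecidableEq m] [Fintype n] [DecidableEq n] in
lemma isSymm_dilation (S : Matrix m n ℝ) : (dilation S).IsSymm := by
  simp [dilation, Matrix.IsSymm, fromBlocks_transpose]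

omit [Fintype m] [DecidableEq m] [Fintype n] [DecidableEq n] in
lemma dilation_smul (c : ℝ) (S : Matrix m n ℝ) : dilation (c • S) = c • dilation S := by
  simp [dilation, fromBlocks_smul]

omit [Fintype m] [DecidableEq m] [Fintype n] [DecidableEq n] in
lemma dilation_nsmul (c : ℕ) (S : Matrix m n ℝ) : dilation (c • S) = c • dilation S := by
  simp [← Nat.cast_smul_eq_nsmul ℝ, dilation_smul]

omit [Fintype m] [DecidableEq m] [Fintype n] [DecidableEq n] in
lemma dilation_sub (S T : Matrix m n ℝ) : dilation (S - T) = dilation S - dilation T := by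
  simp [dilation, sub_eq_add_neg, fromBlocks_add, fromBlocks_neg]

omit [Fintype m] [DecidableEq m] [Fintype n] [DecidableEq n] in
lemma dilation_sum {J : Type*} (s : Finset J) (S : J → Matrix m n ℝ) :
    dilation (∑ j ∈ s, S j) = ∑ j ∈ s, dilation (S j) := by
  classical
  induction s using Finset.induction_on with
  | empty => simp [dilation]
  | insert a s ha ih =>
    rw [Finset.sum_insert ha, Finset.sum_insert ha, ← ih]
    simp [dilation, fromBlocks_add]

omit [DecidableEq m] in
lemma norm_le_of_dotProduct_mulVec_le {M : Matrix m n ℝ} {c : ℝ} (hc : 0 ≤ c)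
    (h : ∀ v, (M *ᵥ v) ⬝ᵥ (M *ᵥ v) ≤ c ^ 2 * (v ⬝ᵥ v)) : ‖M‖ ≤ c := by
  rw [l2_opNorm_def]
  refine ContinuousLinearMap.opNorm_le_bound _ hc fun x => ?_
  have : ∀ y : EuclideanSpace ℝ n, ‖y‖ = Real.sqrt (y.ofLp ⬝ᵥ y.ofLp) :=
    fun y => norm_toLp_eq_sqrt y.ofLp
  rw [this x]
  change ‖WithLp.toLp 2 (M *ᵥ x.ofLp)‖ ≤ _
  rw [norm_toLp_eq_sqrt, ← Real.sqrt_sq hc, ← Real.sqrt_mul (by positivity)]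
  exact Real.sqrt_le_sqrt (h _)

omit [DecidableEq m] in
lemma dotProduct_mulVec_self_le (M : Matrix m n ℝ) (v : n → ℝ) :
    (M *ᵥ v) ⬝ᵥ (M *ᵥ v) ≤ ‖M‖ ^ 2 * (v ⬝ᵥ v) := by
  have h : ‖WithLp.toLp 2 (M *ᵥ v)‖ ≤ _ := Matrix.l2_opNorm_mulVec M (WithLp.toLp 2 v)
  rw [norm_toLp_eq_sqrt, norm_toLp_eq_sqrt] at h
  have h1 : 0 ≤ (M *ᵥ v) ⬝ᵥ (M *ᵥ v) := by simpa using dotProduct_star_self_nonneg (M *ᵥ v)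
  have h2 : 0 ≤ v ⬝ᵥ v := by simpa using dotProduct_star_self_nonneg v
  rw [← Real.sq_sqrt h1, ← Real.sq_sqrt h2, ← mul_pow]
  gcongr

omit [DecidableEq m] [DecidableEq n] in
lemma dilation_mulVec (S : Matrix m n ℝ) (u : m → ℝ) (v : n → ℝ) :
    dilation S *ᵥ Sum.elim u v = Sum.elim (S *ᵥ v) (Sᵀ *ᵥ u) := by
  simp [dilation, fromBlocks_mulVec]

lemma norm_dilation (S : Matrix m n ℝ) : ‖dilation S‖ = ‖S‖ := by
  refine le_antisymm (norm_le_of_dotProduct_mulVec_le (norm_nonneg _) fun w => ?_)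
    (norm_le_of_dotProduct_mulVec_le (norm_nonneg _) fun v => ?_)
  · obtain ⟨u, v, rfl⟩ : ∃ u v, w = Sum.elim u v := ⟨w ∘ Sum.inl, w ∘ Sum.inr, by simp⟩
    rw [dilation_mulVec, sumElim_dotProduct_sumElim, sumElim_dotProduct_sumElim]
    have h1 := dotProduct_mulVec_self_le S v
    have h2 := dotProduct_mulVec_self_le Sᵀ u
    rw [← conjTranspose_eq_transpose_of_trivial, l2_opNorm_conjTranspose,
      conjTranspose_eq_transpose_of_trivial] at h2
    linarith
  · have := dotProduct_mulVec_self_le (dilation S) (Sum.elim 0 v)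
    simpa [dilation_mulVec, sumElim_dotProduct_sumElim] using this

/-- Conjugation by the block matrix `diag(1, -1)` changes the sign of the dilation. -/
lemma trace_exp_neg_dilation (S : Matrix m n ℝ) :
    (exp (-dilation S)).trace = (exp (dilation S)).trace := by
  let U : (Matrix (m ⊕ n) (m ⊕ n) ℝ)ˣ :=
    ⟨fromBlocks 1 0 0 (-1), fromBlocks 1 0 0 (-1), by simp [fromBlocks_multiply],
      by simp [fromBlocks_multiply]⟩
  have h : -dilation S = (U : Matrix (m ⊕ n) (m ⊕ n) ℝ) * dilation S * (U⁻¹ : (Matrix _ _ ℝ)ˣ) := by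
    change _ = fromBlocks 1 0 0 (-1) * _ * fromBlocks 1 0 0 (-1)
    simp [dilation, fromBlocks_multiply, fromBlocks_neg]
  rw [h, Matrix.exp_units_conj, Matrix.trace_mul_comm, ← Matrix.mul_assoc, Units.inv_mul,
    Matrix.one_mul]

/-- The norm is attained as some `|eigenvalue|`. If that eigenvalue is negative, the sign symmetry
of the spectrum gives the same trace, so one trace serves both signs and the dimension factor is `d₁
+ d₂`, not twice that. -/
theorem exp_norm_le_trace_exp_dilation [Nonempty m] (S : Matrix m n ℝ) :
    Real.exp ‖S‖ ≤ (exp (dilation S)).trace := by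
  have hD : (dilation S).IsHermitian := isSymm_dilation S
  have key : ∀ c i, Real.exp (c * hD.eigenvalues i) ≤ (exp (c • dilation S)).trace := fun c i => by
    rw [hD.trace_exp_smul]
    exact Finset.single_le_sum (f := fun i => Real.exp (c * hD.eigenvalues i))
      (fun j _ => (Real.exp_pos _).le) (Finset.mem_univ i)
  obtain ⟨i, hi⟩ := hD.exists_abs_eigenvalues_ge_norm
  rw [norm_dilation] at hi
  refine (Real.exp_le_exp.mpr hi).trans ?_
  rcases abs_choice (hD.eigenvalues i) with h | h
  · simpa [h] using key 1 i
  · simpa [h, trace_exp_neg_dilation] using key (-1) i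

lemma dotProduct_dilation_mul_dilation_mulVec (S : Matrix m n ℝ) (u : m → ℝ) (v : n → ℝ) :
    Sum.elim u v ⬝ᵥ (dilation S * dilation S) *ᵥ Sum.elim u v =
      u ⬝ᵥ (S * Sᵀ) *ᵥ u + v ⬝ᵥ (Sᵀ * S) *ᵥ v := by
  simp [dilation, fromBlocks_multiply, fromBlocks_mulVec, sumElim_dotProduct_sumElim]

end Matrix

/-! ### The tail bound for finitely many jump values. -/

open NormedSpace in
/-- Loewner bound for the compensated cumulant of the dilations of a family of matrices. -/
lemma Matrix.dotProduct_sum_exp_dilation_le {m n : Type*} [Fintype m] [DecidableEq m] [Fintype n]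
    [DecidableEq n] [Nonempty m] {J : Type*} [Fintype J] {lam : J → ℝ} (hlam : ∀ j, 0 ≤ lam j)
    {S : J → Matrix m n ℝ} {L V θ : ℝ} (hS : ∀ j, ‖S j‖ ≤ L) (hθ : 0 ≤ θ) (hθL : θ * L < 3)
    (hV1 : ‖∑ j, lam j • (S j * (S j)ᵀ)‖ ≤ V) (hV2 : ‖∑ j, lam j • ((S j)ᵀ * S j)‖ ≤ V)
    (w : m ⊕ n → ℝ) :
    w ⬝ᵥ (∑ j, lam j • (exp (θ • dilation (S j)) - 1 - θ • dilation (S j))) *ᵥ w ≤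
      ((1 / 2) / (1 - θ * L / 3) * θ ^ 2 * V) * (w ⬝ᵥ w) := by
  obtain ⟨u, v, rfl⟩ : ∃ u v, w = Sum.elim u v := ⟨w ∘ Sum.inl, w ∘ Sum.inr, by simp⟩
  have hg : 0 ≤ (1 / 2) / (1 - θ * L / 3) :=
    div_nonneg (by norm_num) (by linarith)
  have hu : 0 ≤ u ⬝ᵥ u := by simpa using dotProduct_star_self_nonneg u
  have hv : 0 ≤ v ⬝ᵥ v := by simpa using dotProduct_star_self_nonneg v
  rw [dotProduct_sum_mulVec]
  calc ∑ j, Sum.elim u v ⬝ᵥ (lam j • (exp (θ • dilation (S j)) - 1 - θ • dilation (S j))) *ᵥ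
        Sum.elim u v
      ≤ ∑ j, lam j * ((1 / 2) / (1 - θ * L / 3) * (θ ^ 2 *
        (u ⬝ᵥ (S j * (S j)ᵀ) *ᵥ u + v ⬝ᵥ ((S j)ᵀ * S j) *ᵥ v))) := by
        refine Finset.sum_le_sum fun j _ => ?_
        rw [smul_mulVec, dotProduct_smul, smul_eq_mul]
        refine mul_le_mul_of_nonneg_left ?_ (hlam j)
        have h := IsSymm.dotProduct_exp_mulVec_le ((isSymm_dilation (S j)).smul θ) (r := θ * L)
          (by rw [norm_smul, Real.norm_of_nonneg hθ, norm_dilation]; gcongr; exact hS j) hθL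
          (Sum.elim u v)
        refine h.trans_eq ?_
        rw [Matrix.smul_mul, Matrix.mul_smul, smul_smul, smul_mulVec, dotProduct_smul,
          dotProduct_dilation_mul_dilation_mulVec, smul_eq_mul, sq]
    _ = (1 / 2) / (1 - θ * L / 3) * θ ^ 2 * (u ⬝ᵥ (∑ j, lam j • (S j * (S j)ᵀ)) *ᵥ u +
        v ⬝ᵥ (∑ j, lam j • ((S j)ᵀ * S j)) *ᵥ v) := by
        rw [dotProduct_sum_mulVec, dotProduct_sum_mulVec, ← Finset.sum_add_distrib, Finset.mul_sum]
        refine Finset.sum_congr rfl fun j _ => ?_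
        simp only [smul_mulVec, dotProduct_smul, smul_eq_mul]
        ring
    _ ≤ (1 / 2) / (1 - θ * L / 3) * θ ^ 2 * (V * (u ⬝ᵥ u) + V * (v ⬝ᵥ v)) := by
        gcongr
        · exact (dotProduct_mulVec_le_norm _ _).trans (by gcongr)
        · exact (dotProduct_mulVec_le_norm _ _).trans (by gcongr)
    _ = _ := by rw [sumElim_dotProduct_sumElim]; ring

open NormedSpace Matrix in
/-- Exponential tail bound for a matrix compound Poisson variable with finitely many jump values. -/
theorem measure_le_norm_sum_poisson_smul_sub {Ω : Type*} [MeasurableSpace Ω] (P : Measure Ω)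
    {m n : Type*} [Fintype m] [DecidableEq m] [Fintype n]
    [DecidableEq n] [Nonempty m] {J : Type*} [Fintype J] {lam : J → ℝ}
    (hlam : ∀ j, 0 ≤ lam j) {M : J → Ω → ℕ∞}
    (hM : ∀ k : J → ℕ, P (⋂ j, {ω | M j ω = k j}) ≤
      ENNReal.ofReal (∏ j, Real.exp (-lam j) * lam j ^ k j / (k j).factorial))
    {S : J → Matrix m n ℝ} {L V θ s : ℝ} (hS : ∀ j, ‖S j‖ ≤ L) (hθ : 0 ≤ θ) (hθL : θ * L < 3)
    (hV1 : ‖∑ j, lam j • (S j * (S j)ᵀ)‖ ≤ V) (hV2 : ‖∑ j, lam j • ((S j)ᵀ * S j)‖ ≤ V) :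
    P {ω | (∀ j, M j ω ≠ ⊤) ∧ s ≤ ‖∑ j, (M j ω).toNat • S j - ∑ j, lam j • S j‖} ≤
      ENNReal.ofReal ((Fintype.card m + Fintype.card n) *
        Real.exp (-(θ * s) + (1 / 2) / (1 - θ * L / 3) * θ ^ 2 * V)) := by
  classical
  -- Markov's inequality done by hand: the event is a countable union over bad count vectors, and
  -- each bad vector has trace exponential at least `exp (θ * s)`. Only an upper bound on the joint
  -- point probabilities enters.
  let bad : Set (J → ℕ) := {k | s ≤ ‖∑ j, k j • S j - ∑ j, lam j • S j‖}
  have hsub : {ω | (∀ j, M j ω ≠ ⊤) ∧ s ≤ ‖∑ j, (M j ω).toNat • S j - ∑ j, lam j • S j‖} ⊆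
      ⋃ k : bad, ⋂ j, {ω | M j ω = k.1 j} := by
    rintro ω ⟨h1, h2⟩
    refine Set.mem_iUnion.mpr ⟨⟨fun j => (M j ω).toNat, h2⟩, Set.mem_iInter.mpr fun j => ?_⟩
    exact (ENat.natCast_toNat (h1 j)).symm
  refine (measure_mono hsub).trans ((measure_iUnion_le _).trans ?_)
  rw [ENNReal.tsum_eq_iSup_sum]
  refine iSup_le fun K => ?_
  set p : (J → ℕ) → ℝ := fun k => ∏ j, Real.exp (-lam j) * lam j ^ k j / (k j).factorial with hp
  have hp0 : ∀ k, 0 ≤ p k := fun k => Finset.prod_nonneg fun j _ => by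
    have := hlam j; positivity
  refine (Finset.sum_le_sum fun k _ => hM k.1).trans ?_
  rw [← ENNReal.ofReal_sum_of_nonneg fun k _ => hp0 k.1]
  refine ENNReal.ofReal_le_ofReal ?_
  have hmain := sum_prod_poisson_mul_trace_exp_le hlam
    (fun j => (isSymm_dilation (S j)).smul θ)
    (dotProduct_sum_exp_dilation_le hlam hS hθ hθL hV1 hV2) (K.map (Function.Embedding.subtype _))
  rw [Finset.sum_map] at hmain
  have hk : ∀ k : bad, Real.exp (θ * s) ≤
      (exp (∑ j, k.1 j • (θ • dilation (S j)) - ∑ j, lam j • (θ • dilation (S j)))).trace := by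
    intro k
    have h1 := exp_norm_le_trace_exp_dilation (θ • (∑ j, k.1 j • S j - ∑ j, lam j • S j))
    rw [norm_smul, Real.norm_of_nonneg hθ] at h1
    refine (Real.exp_le_exp.mpr (mul_le_mul_of_nonneg_left k.2 hθ)).trans (h1.trans_eq ?_)
    congr 2
    rw [dilation_smul, dilation_sub, dilation_sum, dilation_sum, smul_sub, Finset.smul_sum,
      Finset.smul_sum]
    congr 1 <;> refine Finset.sum_congr rfl fun j _ => ?_
    · rw [dilation_nsmul, smul_comm]
    · rw [dilation_smul, smul_comm]
  have h2 : Real.exp (θ * s) * ∑ k ∈ K, p k.1 ≤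
      Real.exp ((1 / 2) / (1 - θ * L / 3) * θ ^ 2 * V) * Fintype.card (m ⊕ n) := by
    refine le_trans ?_ hmain
    rw [Finset.mul_sum]
    refine Finset.sum_le_sum fun k _ => ?_
    rw [mul_comm]
    exact mul_le_mul_of_nonneg_left (hk k) (hp0 k.1)
  rw [Real.exp_add, Real.exp_neg]
  rw [Fintype.card_sum, Nat.cast_add] at h2
  rw [mul_left_comm, inv_mul_eq_div, le_div_iff₀ (Real.exp_pos _)]
  linarith

/-! ### Decomposition into small compact cells and the resulting Riemann sums. -/

section Approximation

variable {E : Type*} [MeasurableSpace E] {μ : Measure E} {X : Set E} {J : Type*} [Fintype J]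
  {S : J → Set E}

lemma setIntegral_eq_sum_add_setIntegral_sdiff {B : Type*} [NormedAddCommGroup B]
    [NormedSpace ℝ B] (hX : MeasurableSet X) (hS : ∀ j, MeasurableSet (S j))
    (hSX : ∀ j, S j ⊆ X) (hdisj : Pairwise fun i j => Disjoint (S i) (S j)) {g : E → B}
    (hg : IntegrableOn g X μ) :
    ∫ x in X, g x ∂μ = ∑ j, ∫ x in S j, g x ∂μ + ∫ x in X \ ⋃ j, S j, g x ∂μ := by
  have hKX : ⋃ j, S j ⊆ X := Set.iUnion_subset hSX
  rw [← integral_iUnion_fintype hS hdisj fun j => hg.mono_set (hSX j),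
    ← setIntegral_union Set.disjoint_sdiff_right (hX.diff (MeasurableSet.iUnion hS))
      (hg.mono_set hKX) (hg.mono_set Set.sdiff_subset), Set.union_sdiff_cancel hKX]

/-- Riemann-type sums for a weighted integral. -/
lemma norm_setIntegral_smul_sub_sum_le {B : Type*} [NormedAddCommGroup B] [NormedSpace ℝ B]
    [CompleteSpace B] (hX : MeasurableSet X) {lam : E → ℝ}
    (hlam : ∀ x ∈ X, 0 ≤ lam x) (hint : IntegrableOn lam X μ)
    (hS : ∀ j, MeasurableSet (S j)) (hSX : ∀ j, S j ⊆ X)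
    (hdisj : Pairwise fun i j => Disjoint (S i) (S j)) {c : J → E} {G : E → B}
    (hG : IntegrableOn (fun x => lam x • G x) X μ) {C η δ : ℝ} (hC : ∀ x ∈ X, ‖G x‖ ≤ C)
    (hC0 : 0 ≤ C) (hη : 0 ≤ η) (hosc : ∀ j, ∀ x ∈ S j, ‖G x - G (c j)‖ ≤ η)
    (hδ : ∫ x in X, lam x ∂μ - ∑ j, ∫ x in S j, lam x ∂μ ≤ δ) :
    ‖∫ x in X, lam x • G x ∂μ - ∑ j, (∫ x in S j, lam x ∂μ) • G (c j)‖
      ≤ η * (∫ x in X, lam x ∂μ) + C * δ := by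
  have hKX : ⋃ j, S j ⊆ X := Set.iUnion_subset hSX
  have hKm := MeasurableSet.iUnion hS
  have h1 := setIntegral_eq_sum_add_setIntegral_sdiff hX hS hSX hdisj hG
  have h2 := setIntegral_eq_sum_add_setIntegral_sdiff hX hS hSX hdisj hint
  have h3 : ∀ j, ∫ x in S j, lam x • G x ∂μ - (∫ x in S j, lam x ∂μ) • G (c j) =
      ∫ x in S j, lam x • (G x - G (c j)) ∂μ := fun j => by
    rw [← integral_smul_const, ← integral_sub (hG.mono_set (hSX j))
      ((hint.mono_set (hSX j)).smul_const _)]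
    simp_rw [smul_sub]
  have h4 : ∀ j, ‖∫ x in S j, lam x • (G x - G (c j)) ∂μ‖ ≤ η * ∫ x in S j, lam x ∂μ := fun j => by
    rw [← integral_const_mul]
    refine norm_integral_le_of_norm_le ((hint.mono_set (hSX j)).const_mul η) ?_
    refine (ae_restrict_iff' (hS j)).mpr (Filter.Eventually.of_forall fun x hx => ?_)
    rw [norm_smul, Real.norm_of_nonneg (hlam x (hSX j hx)), mul_comm]
    exact mul_le_mul_of_nonneg_right (hosc j x hx) (hlam x (hSX j hx))
  have h5 : ‖∫ x in X \ ⋃ j, S j, lam x • G x ∂μ‖ ≤ C * ∫ x in X \ ⋃ j, S j, lam x ∂μ := by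
    rw [← integral_const_mul]
    refine norm_integral_le_of_norm_le ((hint.mono_set Set.sdiff_subset).const_mul C) ?_
    refine (ae_restrict_iff' (hX.diff hKm)).mpr (Filter.Eventually.of_forall fun x hx => ?_)
    rw [norm_smul, Real.norm_of_nonneg (hlam x hx.1), mul_comm]
    exact mul_le_mul_of_nonneg_right (hC x hx.1) (hlam x hx.1)
  have h6 : 0 ≤ ∫ x in X \ ⋃ j, S j, lam x ∂μ :=
    setIntegral_nonneg (hX.diff hKm) fun x hx => hlam x hx.1
  rw [h1, add_sub_right_comm, ← Finset.sum_sub_distrib]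
  simp_rw [h3]
  calc _ ≤ ∑ j, η * ∫ x in S j, lam x ∂μ + C * ∫ x in X \ ⋃ j, S j, lam x ∂μ :=
        (norm_add_le _ _).trans (add_le_add
          ((norm_sum_le _ _).trans (Finset.sum_le_sum fun j _ => h4 j)) h5)
    _ ≤ _ := by
        rw [← Finset.mul_sum]
        gcongr <;> linarith

end Approximation

/-- Inner regularity makes the measure of `A \ K` small, and absolute continuity of the integral
then makes its weight small. Cells must be compact because the process is only described through
counts on compact sets. -/
lemma exists_isCompact_subset_setIntegral_sdiff_lt {E : Type*} [MeasurableSpace E]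
    [TopologicalSpace E] [OpensMeasurableSpace E] [T2Space E] {μ : Measure E}
    [μ.InnerRegularCompactLTTop] {A : Set E} (hA : MeasurableSet A) (hμA : μ A ≠ ⊤) {lam : E → ℝ}
    (hint : IntegrableOn lam A μ) {ε : ℝ} (hε : 0 < ε) :
    ∃ K ⊆ A, IsCompact K ∧ ∫ x in A \ K, lam x ∂μ < ε := by
  obtain ⟨δ, hδ, h⟩ := exists_pos_setLIntegral_lt_of_measure_lt (μ := μ.restrict A)
    (f := fun x => ‖lam x‖ₑ) hint.2.ne (ENNReal.ofReal_pos.mpr hε).ne'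
  obtain ⟨K, hKA, hK, hlt⟩ := hA.exists_isCompact_sdiff_lt hμA hδ.ne'
  refine ⟨K, hKA, hK, ?_⟩
  have hm : MeasurableSet (A \ K) := hA.diff hK.measurableSet
  have h1 := h (A \ K) ((Measure.restrict_apply_le _ _).trans_lt hlt)
  rw [Measure.restrict_restrict hm, Set.inter_eq_left.mpr Set.sdiff_subset] at h1
  have h2 := (enorm_integral_le_lintegral_enorm (μ := μ.restrict (A \ K)) lam).trans_lt h1
  rw [← ofReal_norm, ENNReal.ofReal_lt_ofReal_iff hε] at h2
  exact (le_abs_self _).trans_lt h2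

/-- A compact set is exhausted, up to small weight, by finitely many disjoint small compact sets. -/
lemma exists_disjoint_compacts {E : Type*} [MeasurableSpace E] [PseudoMetricSpace E] [T2Space E]
    [OpensMeasurableSpace E] {μ : Measure E} [μ.InnerRegularCompactLTTop]
    [IsFiniteMeasureOnCompacts μ] {X : Set E} (hX : IsCompact X) {lam : E → ℝ}
    (hint : IntegrableOn lam X μ) {δ : ℝ} (hδ : 0 < δ) :
    ∃ (w : ℕ) (S : Fin w → Set E) (c : Fin w → E), (∀ i, IsCompact (S i) ∧ S i ⊆ X) ∧
      (Pairwise fun i j => Disjoint (S i) (S j)) ∧ (∀ i, c i ∈ X) ∧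
      (∀ i, ∀ x ∈ S i, dist x (c i) < δ) ∧
      ∫ x in X, lam x ∂μ - ∑ i, ∫ x in S i, lam x ∂μ ≤ δ := by
  obtain ⟨t, htX, htf, hcov⟩ := hX.finite_cover_balls hδ
  have := htf.fintype
  let e := (Fintype.equivFin t).symm
  set w := Fintype.card t
  let b : Fin w → Set E := fun i => Metric.ball (e i : E) δ
  have hbm : ∀ i, MeasurableSet (b i) := fun i => measurableSet_ball
  let A : Fin w → Set E := fun i => X ∩ disjointed b i
  have hXm := hX.measurableSet
  have hAm : ∀ i, MeasurableSet (A i) := fun i =>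
    hXm.inter (disjointedRec (fun t i ht => ht.diff (hbm i)) (hbm i))
  have hAX : ∀ i, A i ⊆ X := fun i => Set.inter_subset_left
  have hAd : Pairwise fun i j => Disjoint (A i) (A j) := fun i j hij =>
    (disjoint_disjointed b hij).mono Set.inter_subset_right Set.inter_subset_right
  have hAu : ⋃ i, A i = X := by
    rw [← Set.inter_iUnion, iUnion_disjointed, Set.inter_eq_left]
    intro x hx
    obtain ⟨y, hy, hxy⟩ := Set.mem_iUnion₂.mp (hcov hx)
    exact Set.mem_iUnion.mpr ⟨e.symm ⟨y, hy⟩, by simpa [b] using hxy⟩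
  have hpos : 0 < δ / (w + 1) := by positivity
  choose S hSA hSc hS using fun i => exists_isCompact_subset_setIntegral_sdiff_lt (hAm i)
    ((measure_mono (hAX i)).trans_lt hX.measure_lt_top).ne (hint.mono_set (hAX i)) hpos
  -- The reference points are the ball centres. They lie in `X` but perhaps not in their cells,
  -- which may be empty.
  refine ⟨w, S, fun i => e i, fun i => ⟨hSc i, (hSA i).trans (hAX i)⟩,
    fun i j hij => (hAd hij).mono (hSA i) (hSA j), fun i => htX (e i).2, fun i x hx => ?_, ?_⟩
  · exact disjointed_subset b i (hSA i hx).2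
  · have h1 : ∫ x in X, lam x ∂μ = ∑ i, ∫ x in A i, lam x ∂μ := by
      rw [← integral_iUnion_fintype hAm hAd fun i => hint.mono_set (hAX i), hAu]
    have h2 : ∀ i, ∫ x in A i, lam x ∂μ - ∫ x in S i, lam x ∂μ ≤ δ / (w + 1) := fun i => by
      have h3 := setIntegral_union (f := lam) (μ := μ) (Set.disjoint_sdiff_right (s := S i) (t := A i))
        ((hAm i).diff (hSc i).measurableSet) (hint.mono_set ((hSA i).trans (hAX i)))
        (hint.mono_set (Set.sdiff_subset.trans (hAX i)))
      rw [Set.union_sdiff_cancel (hSA i)] at h3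
      linarith [hS i]
    rw [h1, ← Finset.sum_sub_distrib]
    refine (Finset.sum_le_sum fun i _ => h2 i).trans ?_
    rw [Finset.sum_const, Finset.card_univ, Fintype.card_fin, nsmul_eq_mul, mul_div_assoc',
      div_le_iff₀ (by positivity)]
    nlinarith

/-! ### Cell counts of configurations and of Poisson processes. -/

section Counts

variable {D : ℕ} {X : Set (EuclideanSpace ℝ (Fin D))}

/-- Comparison of a sum over a finite configuration with the sum over its cell counts. -/
lemma norm_finsum_sub_sum_count_le {B : Type*} [NormedAddCommGroup B] [NormedSpace ℝ B]
    {A : Set (EuclideanSpace ℝ (Fin D))} (hAX : A ⊆ X) (hfin : pointCount X A ≠ ⊤) {J : Type*}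
    [Fintype J] {S : J → Set (EuclideanSpace ℝ (Fin D))}
    (hdisj : Pairwise fun i j => Disjoint (S i) (S j))
    (hcount : pointCount (⋃ j, S j) A = pointCount X A) {F : EuclideanSpace ℝ (Fin D) → B}
    {c : J → EuclideanSpace ℝ (Fin D)} {η : ℝ}
    (hosc : ∀ j, ∀ x ∈ S j, ‖F x - F (c j)‖ ≤ η) :
    ‖∑ᶠ x ∈ A, F x - ∑ j, (pointCount (S j) A).toNat • F (c j)‖ ≤ (pointCount X A).toNat * η := by
  classical
  have hAX' : A ∩ X = A := Set.inter_eq_left.mpr hAX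
  rw [pointCount, pointCount, hAX'] at hcount
  rw [pointCount, hAX', Set.encard_ne_top_iff] at hfin
  -- Finiteness matters here: a subset with the same finite cardinality is everything, so every
  -- point lies in some cell.
  have hAK : A ∩ ⋃ j, S j = A :=
    (hfin.subset Set.inter_subset_left).eq_of_subset_of_encard_le Set.inter_subset_left hcount.ge
  obtain ⟨s, rfl⟩ := hfin.exists_finset_coe
  have hcard : ∀ j, (pointCount (S j) (s : Set (EuclideanSpace ℝ (Fin D)))).toNat =
      (s.filter (· ∈ S j)).card := fun j => by
    have : (s : Set (EuclideanSpace ℝ (Fin D))) ∩ S j = (s.filter (· ∈ S j) : Finset _) := by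
      ext; simp
    rw [pointCount, this, Set.encard_coe_eq_coe_finsetCard, ENat.toNat_natCast]
  have hX : (pointCount X (s : Set (EuclideanSpace ℝ (Fin D)))).toNat = s.card := by
    rw [pointCount, hAX']; simp
  have hsum : ∑ᶠ x ∈ (s : Set (EuclideanSpace ℝ (Fin D))), F x -
      ∑ j, (pointCount (S j) (s : Set (EuclideanSpace ℝ (Fin D)))).toNat • F (c j) =
      ∑ x ∈ s, (F x - ∑ j, if x ∈ S j then F (c j) else 0) := by
    rw [finsum_mem_coe_finset, Finset.sum_sub_distrib, Finset.sum_comm]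
    congr 1
    refine Finset.sum_congr rfl fun j _ => ?_
    rw [hcard, ← Finset.sum_filter, Finset.sum_const]
  rw [hsum, hX, ← nsmul_eq_mul, ← Finset.sum_const]
  refine (norm_sum_le _ _).trans (Finset.sum_le_sum fun x hx => ?_)
  obtain ⟨j, hj⟩ := Set.mem_iUnion.mp (hAK.ge (Finset.mem_coe.mpr hx)).2
  rw [Finset.sum_eq_single j (fun i _ hij => if_neg fun hi =>
    Set.disjoint_left.mp (hdisj hij) hi hj) (by simp), if_pos hj]
  exact hosc j x hj

end Counts

lemma lintegral_natCast_poissonMeasure (r : NNReal) :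
    ∫⁻ k : ℕ, (k : ENNReal) ∂poissonMeasure r = r := by
  have h : HasSum (fun k : ℕ => (k : ℝ) * (Real.exp (-r) * r ^ k / k.factorial)) r := by
    rw [← hasSum_nat_add_iff' 1]
    have h1 := (hasSum_one_poissonMeasure r).mul_left (r : ℝ)
    simp only [Finset.sum_range_one, Nat.cast_zero, zero_mul, sub_zero]
    rw [mul_one] at h1
    refine (congrArg (fun f => HasSum f (r : ℝ)) (funext fun k => ?_)).mpr h1
    rw [Nat.factorial_succ, pow_succ]
    push_cast
    field_simp
  rw [lintegral_countable']
  calc ∑' k : ℕ, (k : ENNReal) * poissonMeasure r {k}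
      = ∑' k : ℕ, ENNReal.ofReal ((k : ℝ) * (Real.exp (-r) * r ^ k / k.factorial)) := by
        refine tsum_congr fun k => ?_
        rw [poissonMeasure_singleton, ENNReal.ofReal_mul (Nat.cast_nonneg k),
          ENNReal.ofReal_natCast]
    _ = r := by
        rw [← ENNReal.ofReal_tsum_of_nonneg (fun k => by positivity) h.summable, h.tsum_eq,
          ENNReal.ofReal_coe_nnreal]

namespace IsPoissonPointProcess

variable {Ω : Type*} [MeasurableSpace Ω] {P : Measure Ω} {D : ℕ}
  {X : Set (EuclideanSpace ℝ (Fin D))} {lam : EuclideanSpace ℝ (Fin D) → ℝ}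
  {N : Ω → Set (EuclideanSpace ℝ (Fin D))}

lemma measure_pointCount_eq (hN : IsPoissonPointProcess P X lam N)
    (hlam : ∀ x ∈ X, 0 ≤ lam x) {S : Set (EuclideanSpace ℝ (Fin D))}
    (hS : IsCompact S) (hSX : S ⊆ X) (k : ℕ) :
    P {ω | pointCount S (N ω) = k} = ENNReal.ofReal
      (Real.exp (-∫ x in S, lam x) * (∫ x in S, lam x) ^ k / k.factorial) := by
  rw [(hN.count_law S hS hSX).measure_eq (p := fun c => c = (k : ℕ∞)) (measurableSet_singleton _)]
  have h0 : 0 ≤ ∫ x in S, lam x := setIntegral_nonneg hS.measurableSet fun x hx => hlam x (hSX hx)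
  rw [Measure.map_apply (measurable_of_countable _) MeasurableSet.of_discrete]
  have : (Nat.cast : ℕ → ℕ∞) ⁻¹' {c | c = (k : ℕ∞)} = {k} := by ext; simp
  rw [this, poissonMeasure_singleton, Real.coe_toNNReal _ h0]

lemma lintegral_pointCount (hN : IsPoissonPointProcess P X lam N)
    {S : Set (EuclideanSpace ℝ (Fin D))} (hS : IsCompact S) (hSX : S ⊆ X) :
    ∫⁻ ω, (pointCount S (N ω) : ENNReal) ∂P = ENNReal.ofReal (∫ x in S, lam x) := by
  have h := hN.count_law S hS hSX
  have hm : Measurable (fun c : ℕ∞ => (c : ENNReal)) := measurable_of_countable _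
  rw [← lintegral_map' (f := fun c : ℕ∞ => (c : ENNReal)) hm.aemeasurable h.aemeasurable, h.map_eq,
    lintegral_map hm (measurable_of_countable _)]
  exact lintegral_natCast_poissonMeasure _

/-- The set `X \ K` need not be compact, so its count has no prescribed law. The difference of the
two counts has known mean and is at least `1` as soon as it is nonzero; Markov's inequality applies
to it. -/
lemma measure_pointCount_ne_le [IsProbabilityMeasure P] (hN : IsPoissonPointProcess P X lam N)
    (hX : IsCompact X) {K : Set (EuclideanSpace ℝ (Fin D))} (hK : IsCompact K) (hKX : K ⊆ X)
    (hlam : ∀ x ∈ X, 0 ≤ lam x) :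
    P {ω | pointCount K (N ω) ≠ pointCount X (N ω)} ≤
      ENNReal.ofReal ((∫ x in X, lam x) - ∫ x in K, lam x) := by
  have hm : Measurable (fun c : ℕ∞ => (c : ENNReal)) := measurable_of_countable _
  have hmeas : ∀ {S : Set (EuclideanSpace ℝ (Fin D))}, IsCompact S → S ⊆ X →
      AEMeasurable (fun ω => (pointCount S (N ω) : ENNReal)) P := fun hS hSX =>
    hm.comp_aemeasurable (hN.count_law _ hS hSX).aemeasurable
  have hle : ∀ ω, pointCount K (N ω) ≤ pointCount X (N ω) := fun ω =>
    Set.encard_le_encard (Set.inter_subset_inter_right _ hKX)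
  have hK0 : 0 ≤ ∫ x in K, lam x := setIntegral_nonneg hK.measurableSet fun x hx => hlam x (hKX hx)
  have hint : ∫⁻ ω, ((pointCount X (N ω) : ENNReal) - (pointCount K (N ω) : ENNReal)) ∂P =
      ENNReal.ofReal ((∫ x in X, lam x) - ∫ x in K, lam x) := by
    rw [lintegral_sub' (hmeas hK hKX) (by rw [hN.lintegral_pointCount hK hKX]; simp)
      (Filter.Eventually.of_forall fun ω => by simpa using hle ω),
      hN.lintegral_pointCount hK hKX, hN.lintegral_pointCount hX subset_rfl,
      ENNReal.ofReal_sub _ hK0]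
  rw [← hint]
  have h1 := mul_meas_ge_le_lintegral₀ ((hmeas hX subset_rfl).sub (hmeas hK hKX)) 1
  rw [one_mul] at h1
  refine le_trans (measure_mono fun ω hω => ?_) h1
  have hlt := lt_of_le_of_ne (hle ω) hω
  simp only [Set.mem_ofPred_eq, Pi.sub_apply]
  have h2 : pointCount K (N ω) + 1 ≤ pointCount X (N ω) := Order.add_one_le_of_lt hlt
  have h3 : (pointCount K (N ω) : ENNReal) + 1 ≤ pointCount X (N ω) := by exact_mod_cast h2
  exact ENNReal.le_sub_of_add_le_left (by simpa using hlt.ne_top) h3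

lemma measure_le_pointCount (hN : IsPoissonPointProcess P X lam N) (hX : IsCompact X) {a : ℝ}
    (ha : 0 < a) :
    P {ω | ENNReal.ofReal a ≤ (pointCount X (N ω) : ENNReal)} ≤
      ENNReal.ofReal ((∫ x in X, lam x) / a) := by
  have hm : Measurable (fun c : ℕ∞ => (c : ENNReal)) := measurable_of_countable _
  have h := meas_ge_le_lintegral_div
    (hm.comp_aemeasurable (hN.count_law _ hX subset_rfl).aemeasurable)
    (ENNReal.ofReal_pos.mpr ha).ne' ENNReal.ofReal_ne_top
  refine h.trans_eq ?_
  rw [ENNReal.ofReal_div_of_pos ha, ← hN.lintegral_pointCount hX subset_rfl]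
  rfl

/-- The joint law of the cell counts of independent Poisson point processes. -/
lemma measure_iInter_pointCount_eq {n w : ℕ} {N : Fin n → Ω → Set (EuclideanSpace ℝ (Fin D))}
    (hN : ∀ i, IsPoissonPointProcess P X lam (N i))
    (hind : iIndepFun (m := fun _ => configurationSigma D) N P)
    (hlam : ∀ x ∈ X, 0 ≤ lam x) {S : Fin w → Set (EuclideanSpace ℝ (Fin D))}
    (hS : ∀ j, IsCompact (S j) ∧ S j ⊆ X) (hdisj : Pairwise fun i j => Disjoint (S i) (S j))
    (k : Fin n × Fin w → ℕ) :
    P (⋂ p : Fin n × Fin w, {ω | pointCount (S p.2) (N p.1 ω) = k p}) =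
      ENNReal.ofReal (∏ p : Fin n × Fin w, Real.exp (-∫ x in S p.2, lam x) *
        (∫ x in S p.2, lam x) ^ k p / (k p).factorial) := by
  let A : Fin n → Set (Set (EuclideanSpace ℝ (Fin D))) := fun i =>
    ⋂ j, pointCount (S j) ⁻¹' {(k (i, j) : ℕ∞)}
  have hA : ∀ i, MeasurableSet[configurationSigma D] (A i) := fun i => by
    refine @MeasurableSet.iInter _ _ (configurationSigma D) _ _ fun j => ?_
    refine le_iSup (fun S : {S : Set (EuclideanSpace ℝ (Fin D)) // IsCompact S} =>
      MeasurableSpace.comap (pointCount S.1) inferInstance) ⟨S j, (hS j).1⟩ _ ?_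
    exact ⟨_, measurableSet_singleton _, rfl⟩
  have h1 : ⋂ p : Fin n × Fin w, {ω | pointCount (S p.2) (N p.1 ω) = k p} =
      ⋂ i, N i ⁻¹' A i := by
    ext ω; simp [A]
  have h2 : ∀ i, N i ⁻¹' A i =
      ⋂ j, (fun ω => pointCount (S j) (N i ω)) ⁻¹' {(k (i, j) : ℕ∞)} := fun i => by
    ext ω; simp [A]
  have h0 : ∀ j, 0 ≤ ∫ x in S j, lam x := fun j =>
    setIntegral_nonneg (hS j).1.measurableSet fun x hx => hlam x ((hS j).2 hx)
  rw [h1, iIndepFun.meas_iInter hind fun i => ⟨A i, hA i, rfl⟩, Fintype.prod_prod_type,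
    ENNReal.ofReal_prod_of_nonneg fun i _ => Finset.prod_nonneg fun j _ => by
      have := h0 j; positivity]
  refine Finset.prod_congr rfl fun i _ => ?_
  rw [h2, iIndepFun.meas_iInter ((hN i).count_indep w S hS hdisj)
      fun j => ⟨_, measurableSet_singleton _, rfl⟩,
    ENNReal.ofReal_prod_of_nonneg fun j _ => by have := h0 j; positivity]
  exact Finset.prod_congr rfl fun j _ =>
    (hN i).measure_pointCount_eq hlam (hS j).1 (hS j).2 _

end IsPoissonPointProcess

lemma IsCompact.integrableOn_smul_of_continuousOn {E B : Type*} [MeasurableSpace E]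
    [TopologicalSpace E] [T2Space E] [OpensMeasurableSpace E] [NormedAddCommGroup B]
    [NormedSpace ℝ B] [SecondCountableTopologyEither E B] {μ : Measure E} {X : Set E}
    (hX : IsCompact X) {lam : E → ℝ} (hint : IntegrableOn lam X μ) {G : E → B}
    (hG : ContinuousOn G X) : IntegrableOn (fun x => lam x • G x) X μ :=
  hint.smul_continuousOn hG hX

/-! ### From the discretized bound to the Bernstein inequality. -/

section PoissonTail

variable {Ω : Type*} [MeasurableSpace Ω] {P : Measure Ω} [IsProbabilityMeasure P]
  {D d₁ d₂ : ℕ} {X : Set (EuclideanSpace ℝ (Fin D))} {lam : EuclideanSpace ℝ (Fin D) → ℝ}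
  {F : EuclideanSpace ℝ (Fin D) → Matrix (Fin d₁) (Fin d₂) ℝ} {L : ℝ}

/-- Oscillations on cells and uncovered weight are at most `η ^ 2`, while the number of points is
below `η⁻¹` off a set of small probability. Freezing `F` on the cells thus costs at most `η⁻¹ * η ^
2 = η` per process. -/
lemma measureReal_le_norm_sub_le_discretized (hd₁ : 0 < d₁) (hX : IsCompact X)
    (hlam_nonneg : ∀ x ∈ X, 0 ≤ lam x) (hlam_int : IntegrableOn lam X volume)
    (hF : ContinuousOn F X) (hL_nonneg : 0 ≤ L) (hL : ∀ x ∈ X, ‖F x‖ ≤ L)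
    {n : ℕ} {N : Fin n → Ω → Set (EuclideanSpace ℝ (Fin D))}
    (hN : ∀ i, IsPoissonPointProcess P X lam (N i))
    (hind : iIndepFun (m := fun _ => configurationSigma D) N P) (t : ℝ) {θ : ℝ} (hθ : 0 ≤ θ)
    (hθL : θ * L < 3) {η : ℝ} (hη : 0 < η) :
    P.real {ω | t ≤ ‖(∑ i, ∑ᶠ x ∈ N i ω, F x) - (n : ℝ) • (∫ x in X, lam x • F x)‖} ≤
      (n * η ^ 2 + n * ((∫ x in X, lam x) * η)) + ((d₁ : ℝ) + d₂) * Real.exp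
        (-(θ * (t - n * η - n * (η ^ 2 * (∫ x in X, lam x) + L * η ^ 2))) +
          (1 / 2) / (1 - θ * L / 3) * θ ^ 2 *
          (n * (varianceStat X lam F + (η ^ 2 * (∫ x in X, lam x) + L ^ 2 * η ^ 2)))) := by
  have : Nonempty (Fin d₁) := ⟨⟨0, hd₁⟩⟩
  have hXm := hX.measurableSet
  set Λ := ∫ x in X, lam x with hΛ
  have hΛ0 : 0 ≤ Λ := setIntegral_nonneg hXm hlam_nonneg
  have hδ : 0 < η ^ 2 := by positivity
  let G₁ : EuclideanSpace ℝ (Fin D) → Matrix (Fin d₁) (Fin d₁) ℝ := fun x => F x * (F x)ᵀ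
  let G₂ : EuclideanSpace ℝ (Fin D) → Matrix (Fin d₂) (Fin d₂) ℝ := fun x => (F x)ᵀ * F x
  have hFt : ContinuousOn (fun x => (F x)ᵀ) X := continuous_id.matrix_transpose.comp_continuousOn hF
  have hG₁ : ContinuousOn G₁ X :=
    (continuous_fst.matrix_mul continuous_snd).comp_continuousOn (hF.prodMk hFt)
  have hG₂ : ContinuousOn G₂ X :=
    (continuous_fst.matrix_mul continuous_snd).comp_continuousOn (hFt.prodMk hF)
  have hnt : ∀ x, ‖(F x)ᵀ‖ = ‖F x‖ := fun x => by
    rw [← Matrix.conjTranspose_eq_transpose_of_trivial, Matrix.l2_opNorm_conjTranspose]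
  have hLsq : ∀ x ∈ X, ‖F x‖ * ‖F x‖ ≤ L ^ 2 := fun x hx => by
    rw [← sq]; exact pow_le_pow_left₀ (norm_nonneg _) (hL x hx) 2
  have hG₁L : ∀ x ∈ X, ‖G₁ x‖ ≤ L ^ 2 := fun x hx =>
    (Matrix.l2_opNorm_mul _ _).trans (by rw [hnt]; exact hLsq x hx)
  have hG₂L : ∀ x ∈ X, ‖G₂ x‖ ≤ L ^ 2 := fun x hx =>
    (Matrix.l2_opNorm_mul _ _).trans (by rw [hnt]; exact hLsq x hx)
  obtain ⟨r₀, hr₀, hu₀⟩ := Metric.uniformContinuousOn_iff.mp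
    (hX.uniformContinuousOn_of_continuous hF) (η ^ 2) hδ
  obtain ⟨r₁, hr₁, hu₁⟩ := Metric.uniformContinuousOn_iff.mp
    (hX.uniformContinuousOn_of_continuous hG₁) (η ^ 2) hδ
  obtain ⟨r₂, hr₂, hu₂⟩ := Metric.uniformContinuousOn_iff.mp
    (hX.uniformContinuousOn_of_continuous hG₂) (η ^ 2) hδ
  obtain ⟨w, S, c, hS, hdisj, hcX, hSc, hrem⟩ := exists_disjoint_compacts (μ := volume) hX hlam_int
    (lt_min hδ (lt_min hr₀ (lt_min hr₁ hr₂)))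
  have hrem' := hrem.trans (min_le_left _ _)
  have hSX : ∀ j, S j ⊆ X := fun j => (hS j).2
  have hSm : ∀ j, MeasurableSet (S j) := fun j => (hS j).1.measurableSet
  have ho₀ : ∀ j, ∀ x ∈ S j, ‖F x - F (c j)‖ ≤ η ^ 2 := fun j x hx => by
    rw [← dist_eq_norm]
    exact (hu₀ x (hSX j hx) _ (hcX j) ((hSc j x hx).trans_le
      ((min_le_right _ _).trans (min_le_left _ _)))).le
  have ho₁ : ∀ j, ∀ x ∈ S j, ‖G₁ x - G₁ (c j)‖ ≤ η ^ 2 := fun j x hx => by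
    rw [← dist_eq_norm]
    exact (hu₁ x (hSX j hx) _ (hcX j) ((hSc j x hx).trans_le
      ((min_le_right _ _).trans ((min_le_right _ _).trans (min_le_left _ _))))).le
  have ho₂ : ∀ j, ∀ x ∈ S j, ‖G₂ x - G₂ (c j)‖ ≤ η ^ 2 := fun j x hx => by
    rw [← dist_eq_norm]
    exact (hu₂ x (hSX j hx) _ (hcX j) ((hSc j x hx).trans_le
      ((min_le_right _ _).trans ((min_le_right _ _).trans (min_le_right _ _))))).le
  set l : Fin w → ℝ := fun j => ∫ x in S j, lam x with hl
  have hl0 : ∀ j, 0 ≤ l j := fun j =>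
    setIntegral_nonneg (hSm j) fun x hx => hlam_nonneg x (hSX j hx)
  have hB := norm_setIntegral_smul_sub_sum_le hXm hlam_nonneg hlam_int hSm hSX hdisj
    (hX.integrableOn_smul_of_continuousOn hlam_int hF) hL hL_nonneg hδ.le ho₀ hrem'
  have hV₁ := norm_setIntegral_smul_sub_sum_le hXm hlam_nonneg hlam_int hSm hSX hdisj
    (hX.integrableOn_smul_of_continuousOn hlam_int hG₁) hG₁L (sq_nonneg L) hδ.le ho₁ hrem'
  have hV₂ := norm_setIntegral_smul_sub_sum_le hXm hlam_nonneg hlam_int hSm hSX hdisj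
    (hX.integrableOn_smul_of_continuousOn hlam_int hG₂) hG₂L (sq_nonneg L) hδ.le ho₂ hrem'
  rw [← hΛ] at hB hV₁ hV₂
  set V := varianceStat X lam F + (η ^ 2 * Λ + L ^ 2 * η ^ 2) with hV
  have hV₁' : ‖∑ j, l j • G₁ (c j)‖ ≤ V := by
    have h1 : ‖∫ x in X, lam x • G₁ x‖ ≤ varianceStat X lam F := le_max_left _ _
    have h2 := norm_sub_norm_le (∑ j, l j • G₁ (c j)) (∫ x in X, lam x • G₁ x)
    rw [norm_sub_rev] at h2
    linarith
  have hV₂' : ‖∑ j, l j • G₂ (c j)‖ ≤ V := by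
    have h1 : ‖∫ x in X, lam x • G₂ x‖ ≤ varianceStat X lam F := le_max_right _ _
    have h2 := norm_sub_norm_le (∑ j, l j • G₂ (c j)) (∫ x in X, lam x • G₂ x)
    rw [norm_sub_rev] at h2
    linarith
  have hpair : ∀ {B : Type} [NormedAddCommGroup B] [NormedSpace ℝ B] (g : Fin w → B),
      ∑ p : Fin n × Fin w, g p.2 = (n : ℝ) • ∑ j, g j := fun g => by
    simp [Fintype.sum_prod_type, Nat.cast_smul_eq_nsmul]
  set s := t - n * η - n * (η ^ 2 * Λ + L * η ^ 2) with hs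
  have htail := measure_le_norm_sum_poisson_smul_sub P (J := Fin n × Fin w)
    (lam := fun p => l p.2) (fun p => hl0 p.2) (M := fun p ω => pointCount (S p.2) (N p.1 ω))
    (fun k => (IsPoissonPointProcess.measure_iInter_pointCount_eq hN hind hlam_nonneg hS hdisj
      k).le) (S := fun p => F (c p.2)) (L := L) (V := n * V) (θ := θ) (s := s)
    (fun p => hL _ (hcX p.2)) hθ hθL
    (by
      rw [hpair (fun j => l j • (F (c j) * (F (c j))ᵀ)), norm_smul, Real.norm_natCast]
      gcongr)
    (by
      rw [hpair (fun j => l j • ((F (c j))ᵀ * F (c j))), norm_smul, Real.norm_natCast]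
      gcongr)
  set T₁ := {ω | (∀ p : Fin n × Fin w, pointCount (S p.2) (N p.1 ω) ≠ ⊤) ∧
    s ≤ ‖∑ p : Fin n × Fin w, (pointCount (S p.2) (N p.1 ω)).toNat • F (c p.2) -
      ∑ p : Fin n × Fin w, l p.2 • F (c p.2)‖} with hT₁
  let T₂ : Fin n → Set Ω := fun i => {ω | pointCount (⋃ j, S j) (N i ω) ≠ pointCount X (N i ω)}
  let T₃ : Fin n → Set Ω := fun i => {ω | ENNReal.ofReal η⁻¹ ≤ (pointCount X (N i ω) : ENNReal)}
  -- Either some process has a point outside the cells (`T₂`), or some process has too many points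
  -- (`T₃`), or the discretized sum deviates by `s`, which is `t` less the approximation errors
  -- (`T₁`).
  have hsub : {ω | t ≤ ‖(∑ i, ∑ᶠ x ∈ N i ω, F x) - (n : ℝ) • (∫ x in X, lam x • F x)‖} ⊆
      ((⋃ i, T₂ i) ∪ ⋃ i, T₃ i) ∪ T₁ := by
    intro ω hω
    by_contra hcon
    simp only [Set.mem_union, Set.mem_iUnion, not_or, not_exists] at hcon
    obtain ⟨⟨h2, h3⟩, h1⟩ := hcon
    have h2 : ∀ i, pointCount (⋃ j, S j) (N i ω) = pointCount X (N i ω) := fun i =>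
      not_not.mp (h2 i)
    have h3 : ∀ i, (pointCount X (N i ω) : ENNReal) < ENNReal.ofReal η⁻¹ := fun i =>
      not_le.mp (h3 i)
    have hfin : ∀ i, pointCount X (N i ω) ≠ ⊤ := fun i htop => by
      have := h3 i
      rw [htop] at this
      simp at this
    have hcount : ∀ i, ((pointCount X (N i ω)).toNat : ℝ) * η ^ 2 ≤ η := fun i => by
      have h4 := h3 i
      rw [← ENat.natCast_toNat (hfin i)] at h4
      have h5 : ((pointCount X (N i ω)).toNat : ℝ) < η⁻¹ := by
        have h6 : ENNReal.ofReal ((pointCount X (N i ω)).toNat : ℝ) < ENNReal.ofReal η⁻¹ := by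
          rw [ENNReal.ofReal_natCast]; exact h4
        exact (ENNReal.ofReal_lt_ofReal_iff (by positivity)).mp h6
      calc _ ≤ η⁻¹ * η ^ 2 := by gcongr
        _ = η := by field_simp
    refine h1 ⟨fun p htop => hfin p.1 (top_le_iff.mp (htop.ge.trans (Set.encard_le_encard
      (Set.inter_subset_inter_right _ (hSX p.2))))), ?_⟩
    have hT : ∀ i, ‖∑ᶠ x ∈ N i ω, F x - ∑ j, (pointCount (S j) (N i ω)).toNat • F (c j)‖ ≤ η :=
      fun i => (norm_finsum_sub_sum_count_le ((hN i).subset ω) (hfin i) hdisj (h2 i) ho₀).trans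
        (hcount i)
    rw [hpair (fun j => l j • F (c j)), Fintype.sum_prod_type]
    have hdec : (∑ i, ∑ᶠ x ∈ N i ω, F x) - (n : ℝ) • (∫ x in X, lam x • F x) =
        (∑ i, (∑ᶠ x ∈ N i ω, F x - ∑ j, (pointCount (S j) (N i ω)).toNat • F (c j))) +
        (∑ i, ∑ j, (pointCount (S j) (N i ω)).toNat • F (c j) - (n : ℝ) • ∑ j, l j • F (c j)) -
        (n : ℝ) • ((∫ x in X, lam x • F x) - ∑ j, l j • F (c j)) := by
      rw [Finset.sum_sub_distrib, smul_sub]; abel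
    have hω : t ≤ _ := hω
    rw [hdec] at hω
    have e1 := norm_sub_le ((∑ i, (∑ᶠ x ∈ N i ω, F x -
        ∑ j, (pointCount (S j) (N i ω)).toNat • F (c j))) +
        (∑ i, ∑ j, (pointCount (S j) (N i ω)).toNat • F (c j) - (n : ℝ) • ∑ j, l j • F (c j)))
        ((n : ℝ) • ((∫ x in X, lam x • F x) - ∑ j, l j • F (c j)))
    have e2 := norm_add_le (∑ i, (∑ᶠ x ∈ N i ω, F x -
        ∑ j, (pointCount (S j) (N i ω)).toNat • F (c j)))
        (∑ i, ∑ j, (pointCount (S j) (N i ω)).toNat • F (c j) - (n : ℝ) • ∑ j, l j • F (c j))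
    have e3 : ‖∑ i, (∑ᶠ x ∈ N i ω, F x -
        ∑ j, (pointCount (S j) (N i ω)).toNat • F (c j))‖ ≤ n * η := by
      refine (norm_sum_le _ _).trans ((Finset.sum_le_sum fun i _ => hT i).trans_eq ?_)
      simp
    have e4 : ‖(n : ℝ) • ((∫ x in X, lam x • F x) - ∑ j, l j • F (c j))‖ ≤
        n * (η ^ 2 * Λ + L * η ^ 2) := by
      rw [norm_smul, Real.norm_natCast]
      gcongr
    change s ≤ _
    linarith
  have hKc : IsCompact (⋃ j, S j) := isCompact_iUnion fun j => (hS j).1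
  have hΛK : (∫ x in X, lam x) - ∫ x in ⋃ j, S j, lam x ≤ η ^ 2 := by
    rwa [integral_iUnion_fintype hSm hdisj fun j => hlam_int.mono_set (hSX j)]
  have hT₂ : P.real (⋃ i, T₂ i) ≤ n * η ^ 2 := by
    refine (measureReal_iUnion_fintype_le _).trans ?_
    refine (Finset.sum_le_sum fun i _ => ?_ : _ ≤ ∑ _i : Fin n, η ^ 2).trans_eq (by simp)
    exact ENNReal.toReal_le_of_le_ofReal hδ.le (((hN i).measure_pointCount_ne_le hX hKc
      (Set.iUnion_subset hSX) hlam_nonneg).trans (ENNReal.ofReal_le_ofReal hΛK))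
  have hT₃ : P.real (⋃ i, T₃ i) ≤ n * (Λ * η) := by
    refine (measureReal_iUnion_fintype_le _).trans ?_
    refine (Finset.sum_le_sum fun i _ => ?_ : _ ≤ ∑ _i : Fin n, Λ * η).trans_eq (by simp)
    refine ENNReal.toReal_le_of_le_ofReal (by positivity)
      (((hN i).measure_le_pointCount hX (inv_pos.mpr hη)).trans_eq ?_)
    rw [div_inv_eq_mul]
  have hT₁' : P.real T₁ ≤ ((d₁ : ℝ) + d₂) * Real.exp
      (-(θ * s) + (1 / 2) / (1 - θ * L / 3) * θ ^ 2 * (n * V)) := by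
    refine ENNReal.toReal_le_of_le_ofReal (by positivity) ?_
    simpa only [Fintype.card_fin] using htail
  calc _ ≤ P.real (((⋃ i, T₂ i) ∪ ⋃ i, T₃ i) ∪ T₁) := measureReal_mono hsub
    _ ≤ (P.real (⋃ i, T₂ i) + P.real (⋃ i, T₃ i)) + P.real T₁ :=
      (measureReal_union_le _ _).trans (add_le_add_left (measureReal_union_le _ _) _)
    _ ≤ _ := add_le_add (add_le_add hT₂ hT₃) hT₁'

lemma measureReal_le_norm_sub_le_exp (hd₁ : 0 < d₁) (hX : IsCompact X)
    (hlam_nonneg : ∀ x ∈ X, 0 ≤ lam x) (hlam_int : IntegrableOn lam X volume)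
    (hF : ContinuousOn F X) (hL_nonneg : 0 ≤ L) (hL : ∀ x ∈ X, ‖F x‖ ≤ L)
    {n : ℕ} {N : Fin n → Ω → Set (EuclideanSpace ℝ (Fin D))}
    (hN : ∀ i, IsPoissonPointProcess P X lam (N i))
    (hind : iIndepFun (m := fun _ => configurationSigma D) N P) (t : ℝ) {θ : ℝ} (hθ : 0 ≤ θ)
    (hθL : θ * L < 3) :
    P.real {ω | t ≤ ‖(∑ i, ∑ᶠ x ∈ N i ω, F x) - (n : ℝ) • (∫ x in X, lam x • F x)‖} ≤
      ((d₁ : ℝ) + d₂) * Real.exp (-(θ * t) +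
        (1 / 2) / (1 - θ * L / 3) * θ ^ 2 * (n * varianceStat X lam F)) := by
  set Λ := ∫ x in X, lam x with hΛ
  have hlim : Filter.Tendsto (fun η : ℝ => (n * η ^ 2 + n * (Λ * η)) + ((d₁ : ℝ) + d₂) * Real.exp
        (-(θ * (t - n * η - n * (η ^ 2 * Λ + L * η ^ 2))) +
          (1 / 2) / (1 - θ * L / 3) * θ ^ 2 *
          (n * (varianceStat X lam F + (η ^ 2 * Λ + L ^ 2 * η ^ 2)))))
      (nhdsWithin 0 (Set.Ioi 0)) (nhds (((d₁ : ℝ) + d₂) * Real.exp (-(θ * t) +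
        (1 / 2) / (1 - θ * L / 3) * θ ^ 2 * (n * varianceStat X lam F)))) := by
    refine Filter.Tendsto.mono_left ?_ nhdsWithin_le_nhds
    exact Continuous.tendsto' (by fun_prop) _ _ (by simp)
  refine ge_of_tendsto hlim ?_
  filter_upwards [self_mem_nhdsWithin] with η hη
  exact measureReal_le_norm_sub_le_discretized hd₁ hX hlam_nonneg hlam_int hF hL_nonneg hL hN hind t hθ
    hθL hη

omit [MeasurableSpace Ω] [IsProbabilityMeasure P] in
lemma varianceStat_nonneg (X : Set (EuclideanSpace ℝ (Fin D)))
    (lam : EuclideanSpace ℝ (Fin D) → ℝ)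
    (F : EuclideanSpace ℝ (Fin D) → Matrix (Fin d₁) (Fin d₂) ℝ) : 0 ≤ varianceStat X lam F :=
  (norm_nonneg _).trans (le_max_left _ _)

/-- Matrix Bernstein inequality for independent Poisson point processes. -/
theorem measureReal_le_norm_sub_le_bernstein (hd₁ : 0 < d₁) (hX : IsCompact X)
    (hlam_nonneg : ∀ x ∈ X, 0 ≤ lam x) (hlam_int : IntegrableOn lam X volume)
    (hF : ContinuousOn F X) (hL_nonneg : 0 ≤ L) (hL : ∀ x ∈ X, ‖F x‖ ≤ L)
    {n : ℕ} {N : Fin n → Ω → Set (EuclideanSpace ℝ (Fin D))}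
    (hN : ∀ i, IsPoissonPointProcess P X lam (N i))
    (hind : iIndepFun (m := fun _ => configurationSigma D) N P) {t : ℝ} (ht : 0 ≤ t) :
    P.real {ω | t ≤ ‖(∑ i, ∑ᶠ x ∈ N i ω, F x) - (n : ℝ) • (∫ x in X, lam x • F x)‖} ≤
      ((d₁ : ℝ) + d₂) *
        Real.exp (-((t ^ 2 / 2) / (n * varianceStat X lam F + L * t / 3))) := by
  set v := n * varianceStat X lam F with hv
  have hv0 : 0 ≤ v := mul_nonneg (Nat.cast_nonneg n) (varianceStat_nonneg X lam F)
  have hd₁' : (1 : ℝ) ≤ d₁ := by exact_mod_cast hd₁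
  have hd : 1 ≤ (d₁ : ℝ) + d₂ := by linarith [(Nat.cast_nonneg d₂ : (0 : ℝ) ≤ d₂)]
  have htail := fun {θ : ℝ} => measureReal_le_norm_sub_le_exp (P := P) (θ := θ) hd₁ hX hlam_nonneg
    hlam_int hF hL_nonneg hL hN hind t
  rw [← hv] at htail
  have hLt : 0 ≤ L * t / 3 := by positivity
  -- With denominator `0` the quotient is `0`, and the bound is `d₁ + d₂ ≥ 1`.
  rcases (add_nonneg hv0 hLt).eq_or_lt with hq | hq
  · rw [← hq]
    simpa using measureReal_le_one.trans hd
  -- Without variance the usual `θ = t / q` would give `θ * L = 3`, just outside the admissible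
  -- range. Half of it, `3 / (2 * L)`, already yields the claimed exponent because the quadratic
  -- term vanishes.
  rcases hv0.eq_or_lt with hv0 | hv0
  · rw [← hv0, zero_add] at hq ⊢
    have hL0 : 0 < L := hL_nonneg.lt_of_ne (by rintro rfl; simp at hq)
    have ht0 : 0 < t := ht.lt_of_ne (by rintro rfl; simp at hq)
    refine (htail (θ := 3 / (2 * L)) (by positivity) ?_).trans_eq ?_
    · field_simp; norm_num
    · rw [← hv0]
      congr 2
      field_simp
      ring
  · set q := v + L * t / 3 with hqd
    -- Bernstein's choice: it makes `1 - θ * L / 3 = v / q`, so the exponent is `-t ^ 2 / q + t ^ 2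
    -- / (2 * q)`.
    refine (htail (θ := t / q) (by positivity) ?_).trans_eq ?_
    · rw [div_mul_eq_mul_div, div_lt_iff₀ hq]
      linarith
    · have h1 : 1 - t / q * L / 3 = v / q := by
        field_simp
        linarith
      rw [h1]
      congr 2
      field_simp
      ring

/-- The high-probability form of the matrix Bernstein inequality. -/
theorem le_measureReal_norm_sub_le_bernstein (hd₁ : 0 < d₁) (hd₂ : 0 < d₂) (hX : IsCompact X)
    (hlam_nonneg : ∀ x ∈ X, 0 ≤ lam x) (hlam_int : IntegrableOn lam X volume)
    (hF : ContinuousOn F X) (hL_nonneg : 0 ≤ L) (hL : ∀ x ∈ X, ‖F x‖ ≤ L)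
    {n : ℕ} {N : Fin n → Ω → Set (EuclideanSpace ℝ (Fin D))}
    (hN : ∀ i, IsPoissonPointProcess P X lam (N i))
    (hind : iIndepFun (m := fun _ => configurationSigma D) N P) {a : ℝ} (ha : 2 ≤ a) :
    1 - 2 * (max (d₁ : ℝ) (d₂ : ℝ)) ^ (1 - a) ≤
      P.real {ω | ‖(∑ i, ∑ᶠ x ∈ N i ω, F x) - (n : ℝ) • (∫ x in X, lam x • F x)‖ ≤
        Real.sqrt (2 * a * (n * varianceStat X lam F) * Real.log ((d₁ : ℝ) + d₂)) +
          2 * a / 3 * L * Real.log ((d₁ : ℝ) + d₂)} := by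
  set v := n * varianceStat X lam F with hv
  have hv0 : 0 ≤ v := mul_nonneg (Nat.cast_nonneg n) (varianceStat_nonneg X lam F)
  set d := (d₁ : ℝ) + d₂ with hd
  have hd₁' : (1 : ℝ) ≤ d₁ := by exact_mod_cast hd₁
  have hd₂' : (1 : ℝ) ≤ d₂ := by exact_mod_cast hd₂
  have hd2 : 2 ≤ d := by linarith
  have hlog : 0 < Real.log d := Real.log_pos (by linarith)
  set t := Real.sqrt (2 * a * v * Real.log d) + 2 * a / 3 * L * Real.log d with ht
  have ht0 : 0 ≤ t := by positivity
  set Y : Ω → Matrix (Fin d₁) (Fin d₂) ℝ := fun ω =>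
    (∑ i, ∑ᶠ x ∈ N i ω, F x) - (n : ℝ) • (∫ x in X, lam x • F x) with hY
  have hmax : 1 ≤ max (d₁ : ℝ) d₂ := hd₁'.trans (le_max_left _ _)
  have hcompl : P.real {ω | ‖Y ω‖ ≤ t}ᶜ ≤ 2 * (max (d₁ : ℝ) (d₂ : ℝ)) ^ (1 - a) := by
    -- For `L = 0` the threshold and the denominator can both be `0`, which makes the tail bound
    -- useless; but then the deviation is identically zero.
    rcases hL_nonneg.eq_or_lt with hL0 | hL0
    · have hF0 : ∀ x ∈ X, F x = 0 := fun x hx => norm_le_zero_iff.mp (hL0 ▸ hL x hx)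
      have hY0 : ∀ ω, Y ω = 0 := fun ω => by
        have e1 : ∀ i, ∑ᶠ x ∈ N i ω, F x = 0 := fun i =>
          finsum_mem_eq_zero_of_forall_eq_zero fun x hx => hF0 x ((hN i).subset ω hx)
        have e2 : ∫ x in X, lam x • F x = 0 :=
          setIntegral_eq_zero_of_forall_eq_zero fun x hx => by rw [hF0 x hx, smul_zero]
        simp [hY, e1, e2]
      have : {ω | ‖Y ω‖ ≤ t}ᶜ = ∅ := by
        ext ω; simp [hY0, ht0]
      rw [this, measureReal_empty]
      positivity
    · have hsub : {ω | ‖Y ω‖ ≤ t}ᶜ ⊆ {ω | t ≤ ‖Y ω‖} := fun ω hω => by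
        simp only [Set.mem_compl_iff, Set.mem_ofPred_eq, not_le] at hω ⊢
        exact hω.le
      have htail := measureReal_le_norm_sub_le_bernstein (P := P) hd₁ hX hlam_nonneg hlam_int hF
        hL_nonneg hL hN hind ht0
      have hs0 := Real.sqrt_nonneg (2 * a * v * Real.log d)
      have hs := Real.sq_sqrt (show 0 ≤ 2 * a * v * Real.log d by positivity)
      have hb : 0 < 2 * a / 3 * L * Real.log d := by positivity
      have htp : 0 < t := add_pos_of_nonneg_of_pos hs0 hb
      have hq : 0 < v + L * t / 3 := by positivity
      -- With `t = σ + b`, `σ` the square root and `b` the linear term, `t ^ 2 ≥ σ ^ 2 + b * t`,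
      -- which is `2 * a * log d` times the denominator.
      have hexp : a * Real.log d ≤ (t ^ 2 / 2) / (v + L * t / 3) := by
        rw [le_div_iff₀ hq]
        have : 2 * a * v * Real.log d + (2 * a / 3 * L * Real.log d) * t ≤ t ^ 2 := by
          rw [← hs, ht]
          nlinarith [mul_nonneg hs0 hb.le]
        linarith
      calc P.real {ω | ‖Y ω‖ ≤ t}ᶜ ≤ d * Real.exp (-((t ^ 2 / 2) / (v + L * t / 3))) :=
            (measureReal_mono hsub).trans htail
        _ ≤ d * Real.exp (-(a * Real.log d)) := by gcongr
        _ = d ^ (1 - a) := by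
            rw [Real.rpow_sub (by linarith), Real.rpow_one, Real.rpow_def_of_pos (by linarith),
              Real.exp_neg, div_eq_mul_inv, mul_comm a]
        _ ≤ (max (d₁ : ℝ) (d₂ : ℝ)) ^ (1 - a) :=
            Real.rpow_le_rpow_of_nonpos (by linarith)
              (max_le (by linarith) (by linarith)) (by linarith)
        _ ≤ 2 * (max (d₁ : ℝ) (d₂ : ℝ)) ^ (1 - a) := by
            have : 0 ≤ (max (d₁ : ℝ) (d₂ : ℝ)) ^ (1 - a) := by positivity
            linarith
  -- Subadditivity suffices, so measurability of the event plays no role.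
  have h1 : (1 : ℝ) ≤ P.real {ω | ‖Y ω‖ ≤ t} + P.real {ω | ‖Y ω‖ ≤ t}ᶜ := by
    have := measureReal_union_le (μ := P) {ω | ‖Y ω‖ ≤ t} {ω | ‖Y ω‖ ≤ t}ᶜ
    rwa [Set.union_compl_self, probReal_univ] at this
  linarith

end PoissonTail

theorem mainTheorem6 {Ω : Type*} [MeasurableSpace Ω] (P : Measure Ω) [IsProbabilityMeasure P]
    {D d₁ d₂ : ℕ} (hd₁ : 0 < d₁) (hd₂ : 0 < d₂)
    (X : Set (EuclideanSpace ℝ (Fin D))) (hX : IsCompact X)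
    (lam : EuclideanSpace ℝ (Fin D) → ℝ) (hlam_nonneg : ∀ x ∈ X, 0 ≤ lam x)
    (hlam_int : IntegrableOn lam X volume)
    (F : EuclideanSpace ℝ (Fin D) → Matrix (Fin d₁) (Fin d₂) ℝ) (hF : ContinuousOn F X)
    (L : ℝ) (hL_nonneg : 0 ≤ L) (hL : ∀ x ∈ X, ‖F x‖ ≤ L) :
    (∀ N : Ω → Set (EuclideanSpace ℝ (Fin D)), IsPoissonPointProcess P X lam N →
      (∀ t : ℝ, 0 ≤ t →
        P.real {ω | t ≤ ‖(∑ᶠ x ∈ N ω, F x) - (∫ x in X, lam x • F x)‖} ≤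
          ((d₁ : ℝ) + d₂) *
            Real.exp (-((t ^ 2 / 2) / (varianceStat X lam F + L * t / 3)))) ∧
      (∀ a : ℝ, 2 ≤ a →
        1 - 2 * (max (d₁ : ℝ) (d₂ : ℝ)) ^ (1 - a) ≤
          P.real {ω | ‖(∑ᶠ x ∈ N ω, F x) - (∫ x in X, lam x • F x)‖ ≤
            Real.sqrt (2 * a * varianceStat X lam F * Real.log ((d₁ : ℝ) + d₂)) +
              2 * a / 3 * L * Real.log ((d₁ : ℝ) + d₂)})) ∧
    (∀ (n : ℕ) (N : Fin n → Ω → Set (EuclideanSpace ℝ (Fin D))),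
      (∀ i, IsPoissonPointProcess P X lam (N i)) →
      iIndepFun (m := fun _ => configurationSigma D) N P →
      (∀ t : ℝ, 0 ≤ t →
        P.real {ω | t ≤ ‖(∑ i, ∑ᶠ x ∈ N i ω, F x) - (n : ℝ) • (∫ x in X, lam x • F x)‖} ≤
          ((d₁ : ℝ) + d₂) *
            Real.exp (-((t ^ 2 / 2) / (n * varianceStat X lam F + L * t / 3)))) ∧
      (∀ a : ℝ, 2 ≤ a →
        1 - 2 * (max (d₁ : ℝ) (d₂ : ℝ)) ^ (1 - a) ≤
          P.real {ω | ‖(∑ i, ∑ᶠ x ∈ N i ω, F x) - (n : ℝ) • (∫ x in X, lam x • F x)‖ ≤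
            Real.sqrt (2 * a * (n * varianceStat X lam F) * Real.log ((d₁ : ℝ) + d₂)) +
              2 * a / 3 * L * Real.log ((d₁ : ℝ) + d₂)})) := by
  refine ⟨fun N hN => ?_, fun n N hN hind => ?_⟩
  -- A single process is the case `n = 1` of the independent family.
  · have hind : iIndepFun (m := fun _ => configurationSigma D) (fun _ : Fin 1 => N) P :=
      iIndepFun.of_subsingleton
    refine ⟨fun t ht => ?_, fun a ha => ?_⟩
    · simpa using measureReal_le_norm_sub_le_bernstein hd₁ hX hlam_nonneg hlam_int hF hL_nonneg hL
        (fun _ => hN) hind ht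
    · simpa using le_measureReal_norm_sub_le_bernstein hd₁ hd₂ hX hlam_nonneg hlam_int hF
        hL_nonneg hL (fun _ => hN) hind ha
  · exact ⟨fun t ht => measureReal_le_norm_sub_le_bernstein hd₁ hX hlam_nonneg hlam_int hF
        hL_nonneg hL hN hind ht,
      fun a ha => le_measureReal_norm_sub_le_bernstein hd₁ hd₂ hX hlam_nonneg hlam_int hF
        hL_nonneg hL hN hind ha⟩
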